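/- Let $(t_\alpha)_{\alpha\in\mathbb Z}$ be real numbers, finitely many but at least one of them nonzero. Let $c_n,c_n^\dagger$ be the annihilation and creation operators of spinless fermions on a chain, let $\gamma_n=c_n^\dagger+c_n$ and $\tilde\gamma_n=i(c_n^\dagger-c_n)$, and let $T$ be complex conjugation in the occupation basis. Consider the BDI Hamiltonian $$H=\frac i2\sum_{\alpha}t_\alpha\sum_n\tilde\gamma_n\gamma_{n+\alpha}$$ on the half-infinite chain with a left boundary (sites $n\ge 1$) and on the half-infinite chain with a right boundary (sites $n\le -1$), where only terms with both sites in the chain are kept. A zero mode is a norm-convergent sum $\Gamma=\sum_n(b_n\gamma_n+\tilde b_n\tilde\gamma_n)$ with real coefficients (equivalently, square-summable ones) such that $[\Gamma,H]=0$; it is real if $T\Gamma T=\Gamma$ and imaginary if $T\Gamma T=-\Gamma$. It has localization length $\xi\ge 0$ if $|b_n|+|\tilde b_n|=O(e^{-|n|/\xi'})$ holds for every $\xi'>\xi$ and for no $\xi'$ with $0<\xi'<\xi$. We say that a boundary has exactly $k$ Majorana zero modes $\Gamma_1,\dots,\Gamma_k$ if these are zero modes of the corresponding half-infinite chain, $\{\Gamma_i,\Gamma_j\}=2\delta_{ij}$,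 and every zero mode of that chain is a real linear combination of them. Let $f(z)=\sum_\alpha t_\alpha z^\alpha$, let $\omega=N_z-N_p$, where $N_z$ is the number of zeros of $f$ with $|z|<1$ (the origin included if $f$ extends to it and vanishes there) and $N_p\ge 0$ is the order of the pole of $f$ at $0$, and let $2c$ be the number of zeros on the unit circle. All zeros are counted with multiplicity. 1. If $\omega>0$, let $z_1,\dots,z_\omega$ be the $\omega$ zeros of $f$ of largest modulus inside the open unit disk. Then each boundary has exactly $\omega$ Majorana zero modes, which can be chosen with localization lengths $\xi_i=-1/\ln|z_i|$ (read as $0$ if $z_i=0$). They are real on the left boundary and imaginary on the right boundary. 2. If $\omega<-2c$, let $z_1,\dots,z_{|\omega+2c|}$ be the $|\omega+2c|$ zeros of $f$ of smallest modulus outside the closed unit disk, where, if all $\alpha$ with $t_\alpha\neq0$ are negative, $\infty$ counts as a zero of multiplicity $-\max\{\alpha:t_\alpha\ne0\}$. Then each boundary has exactly $|\omega+2c|$ Majorana zero modes, which can be chosen with localization lengths $\xi_i=1/\ln|z_i|$ (read as $0$ if $z_i=\infty$). They are imaginary on the left boundary and real on the right boundary. 3. If $-2c\le\omega\le 0$,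 neither boundary has a nonzero zero mode; in particular there are no localized edge modes. -/

import Mathlib

open scoped ENNReal

noncomputable section

namespace BDI

/-! ### The function `f`, its zeros and its pole -/

/-- The function `f(z) = ∑ t_α z ^ α` on the punctured plane. -/
def symbol (t : ℤ →₀ ℝ) (z : ℂ) : ℂ := t.sum fun α a => (a : ℂ) * z ^ α

/-- The order `N_p` of the pole of `f` at the origin: the largest `p ≥ 1` with `t_{-p} ≠ 0`, and `0`
if there is none. -/
def poleOrder (t : ℤ →₀ ℝ) : ℕ := t.support.sup fun α => (-α).toNat

/-- The polynomial `z ^ N_p * f(z)`. If there is a pole, its value at `0` is nonzero; if there is none,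
it is `f` itself, extended to `0`. -/
def numerator (t : ℤ →₀ ℝ) : Polynomial ℂ :=
  t.sum fun α a => Polynomial.monomial (α + poleOrder t).toNat (a : ℂ)

/-- The zeros of `f` in the plane, with multiplicity (the origin counts when `f` extends to a
function that vanishes there). -/
def zeros (t : ℤ →₀ ℝ) : Multiset ℂ := (numerator t).roots

theorem symbol_mul_pow (t : ℤ →₀ ℝ) {z : ℂ} (hz : z ≠ 0) :
    symbol t z * z ^ poleOrder t = (numerator t).eval z := by
  unfold symbol numerator
  rw [Finsupp.sum, Finsupp.sum, Polynomial.eval_finsetSum, Finset.sum_mul]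
  refine Finset.sum_congr rfl fun α hα => ?_
  have h1 : (-α).toNat ≤ poleOrder t := Finset.le_sup (f := fun α : ℤ => (-α).toNat) hα
  have h2 : 0 ≤ α + poleOrder t := by omega
  rw [Polynomial.eval_monomial, mul_assoc, ← zpow_natCast z (poleOrder t), ← zpow_add₀ hz,
    ← zpow_natCast z (Int.toNat _), Int.toNat_of_nonneg h2]

/-- The zeros strictly inside the unit disk, with multiplicity. -/
def zerosInside (t : ℤ →₀ ℝ) : Multiset ℂ := (zeros t).filter fun z => ‖z‖ < 1

/-- The topological invariant `ω = N_z - N_p`. -/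
def omega (t : ℤ →₀ ℝ) : ℤ := (zerosInside t).card - poleOrder t

/-- The number `2c` of zeros on the unit circle, with multiplicity. -/
def twoC (t : ℤ →₀ ℝ) : ℤ := ((zeros t).filter fun z => ‖z‖ = 1).card

/-- The order of the zero of `f` at infinity: `-α` for the largest `α` with `t_α ≠ 0` if that `α` is
negative, and `0` otherwise. -/
def zeroOrderAtInfty (t : ℤ →₀ ℝ) : ℕ := sInf ((fun α : ℤ => (-α).toNat) '' t.support)

/-- The zeros of `f` outside the closed unit disk, in the Riemann sphere, with multiplicity. -/
def zerosOutside (t : ℤ →₀ ℝ) : Multiset (OnePoint ℂ) :=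
  ((zeros t).filter fun z => 1 < ‖z‖).map ((↑) : ℂ → OnePoint ℂ) +
    Multiset.replicate (zeroOrderAtInfty t) OnePoint.infty

/-- The modulus of a point of the Riemann sphere. -/
def modulus : OnePoint ℂ → ℝ≥0∞
  | none => ⊤
  | some z => ‖z‖ₑ

/-- `z` lists (with multiplicity) the `k` largest elements of `s`, with respect to the modulus `m`. -/
def IsLargest {X M : Type*} [LE M] (m : X → M) (s : Multiset X) {k : ℕ}
    (z : Fin k → X) : Prop :=
  ∃ rest : Multiset X, s = Finset.univ.val.map z + rest ∧ ∀ i, ∀ w ∈ rest, m w ≤ m (z i)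

/-- `z` lists (with multiplicity) the `k` smallest elements of `s`, with respect to the modulus `m`. -/
def IsSmallest {X M : Type*} [LE M] (m : X → M) (s : Multiset X) {k : ℕ}
    (z : Fin k → X) : Prop :=
  ∃ rest : Multiset X, s = Finset.univ.val.map z + rest ∧ ∀ i, ∀ w ∈ rest, m (z i) ≤ m w

/-- `ξ = -1 / ln |z|`, for a zero inside the disk. For `z = 0` this is `0` (perfect localization),
also in Lean, where `Real.log 0 = 0`. -/
def insideLength (z : ℂ) : ℝ := -1 / Real.log ‖z‖

/-- `ξ = 1 / ln |z|`, for a zero outside the disk; it is `0` at infinity. -/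
def outsideLength : OnePoint ℂ → ℝ
  | none => 0
  | some z => 1 / Real.log ‖z‖

/-! ### Spinless fermions on a set of sites -/

variable {Λ : Set ℤ}

/-- The Fock space of spinless fermions on the sites `Λ`, in the occupation basis: the basis states
are the finite sets of occupied sites. -/
abbrev Fock (Λ : Set ℤ) : Type := lp (fun _ : Finset Λ => ℂ) 2

/-- Bounded operators on the Fock space. -/
abbrev Op (Λ : Set ℤ) : Type := Fock Λ →L[ℂ] Fock Λ

/-- The fermionic sign `(-1) ^ #{m ∈ S | m < n}`. -/
def fermiSign (n : Λ) (S : Finset Λ) : ℂ := (-1) ^ (S.filter fun m => m < n).card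

theorem norm_fermiSign (n : Λ) (S : Finset Λ) : ‖fermiSign n S‖ = 1 := by
  simp [fermiSign]

/-- The amplitudes of `c_n ψ`. -/
def annihilateFun (n : Λ) (ψ : Finset Λ → ℂ) (S : Finset Λ) : ℂ :=
  if n ∈ S then 0 else fermiSign n S * ψ (insert n S)

theorem sum_annihilateFun_le (n : Λ) (ψ : Fock Λ) (s : Finset (Finset Λ)) :
    ∑ S ∈ s, ‖annihilateFun n ψ S‖ ^ (2 : ℝ≥0∞).toReal ≤ ‖ψ‖ ^ (2 : ℝ≥0∞).toReal := by
  classical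
  have h : ∑ S ∈ s, ‖annihilateFun n ψ S‖ ^ (2 : ℝ≥0∞).toReal =
      ∑ S ∈ (s.filter fun S => n ∉ S).image (insert n), ‖ψ S‖ ^ (2 : ℝ≥0∞).toReal := by
    rw [Finset.sum_image, Finset.sum_filter]
    · refine Finset.sum_congr rfl fun S _ => ?_
      by_cases hn : n ∈ S <;> simp [annihilateFun, hn, norm_fermiSign]
    · intro A hA B hB hAB
      have hA' : n ∉ A := by simpa using (Finset.mem_filter.1 hA).2
      have hB' : n ∉ B := by simpa using (Finset.mem_filter.1 hB).2
      rw [← Finset.erase_insert hA', ← Finset.erase_insert hB', hAB]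
  rw [h]
  exact lp.sum_rpow_le_norm_rpow (by norm_num) ψ _

theorem memℓp_annihilateFun (n : Λ) (ψ : Fock Λ) : Memℓp (annihilateFun n ψ) 2 :=
  memℓp_gen' (sum_annihilateFun_le n ψ)

/-- The annihilation operator `c_n`. -/
def annihilation (n : Λ) : Op Λ :=
  LinearMap.mkContinuous
    { toFun := fun ψ => ⟨annihilateFun n ψ, memℓp_annihilateFun n ψ⟩
      map_add' := fun ψ φ => by
        ext S
        simp only [annihilateFun, lp.coeFn_add, Pi.add_apply]
        split_ifs <;> ring
      map_smul' := fun a ψ => by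
        ext S
        simp only [annihilateFun, lp.coeFn_smul, Pi.smul_apply, smul_eq_mul, RingHom.id_apply]
        split_ifs <;> ring }
    1
    (fun ψ => by
      rw [one_mul]
      exact lp.norm_le_of_forall_sum_le (by norm_num) (norm_nonneg ψ) (sum_annihilateFun_le n ψ))

/-- The creation operator `c_n†`. -/
def creation (n : Λ) : Op Λ := ContinuousLinearMap.adjoint (annihilation n)

/-- The Majorana operator `γ_n = c_n† + c_n`. -/
def gam (n : Λ) : Op Λ := creation n + annihilation n

/-- The Majorana operator `γ̃_n = i (c_n† - c_n)`. -/
def gamTilde (n : Λ) : Op Λ := Complex.I • (creation n - annihilation n)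

/-- The time reversal `T`: complex conjugation in the occupation basis. -/
def timeReversal (ψ : Fock Λ) : Fock Λ := star ψ

/-- `T Γ T = Γ`. -/
def IsRealMode (Γ : Op Λ) : Prop := ∀ ψ, timeReversal (Γ (timeReversal ψ)) = Γ ψ

/-- `T Γ T = -Γ`. -/
def IsImaginaryMode (Γ : Op Λ) : Prop := ∀ ψ, timeReversal (Γ (timeReversal ψ)) = -Γ ψ

/-! ### The Hamiltonian and its zero modes -/

/-- The term `(i / 2) t_{m-n} γ̃_n γ_m` of the Hamiltonian `H = (i / 2) ∑_α t_α ∑_n γ̃_n γ_{n+α}`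
(with `m = n + α`) of the chain with sites `Λ`; pairs with a site outside `Λ` are absent. -/
def bond (t : ℤ →₀ ℝ) (p : Λ × Λ) : Op Λ :=
  ((Complex.I / 2) * (t ((p.2 : ℤ) - p.1) : ℂ)) • (gamTilde p.1 * gam p.2)

/-- `Γ = ∑_n (b_n γ_n + b'_n γ̃_n)` with real coefficients (in operator norm, so that the mode is
normalizable). -/
def HasExpansion (Γ : Op Λ) (b b' : Λ → ℝ) : Prop :=
  HasSum (fun n => (b n : ℂ) • gam n + (b' n : ℂ) • gamTilde n) Γ

/-- `[Γ, H] = 0`, where `H` is the (formal) sum of the bonds: the commutators of `Γ` with the bonds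
sum up to zero in operator norm. -/
def CommutesWithHamiltonian (t : ℤ →₀ ℝ) (Γ : Op Λ) : Prop :=
  HasSum (fun p : Λ × Λ => Γ * bond t p - bond t p * Γ) 0

/-- Normalizable (possibly zero, not yet normalized) Majorana zero modes of the chain on `Λ`. -/
def IsZeroMode (t : ℤ →₀ ℝ) (Γ : Op Λ) : Prop :=
  (∃ b b' : Λ → ℝ, HasExpansion Γ b b') ∧ CommutesWithHamiltonian t Γ

/-- The `k` operators `Γ i` are independent Majorana modes, `{Γ_i, Γ_j} = 2 δ_ij`, they are zero modes,
and they are all of them: every zero mode is a real linear combination of them. -/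
structure AreTheZeroModes (t : ℤ →₀ ℝ) {k : ℕ} (Γ : Fin k → Op Λ) : Prop where
  isZeroMode : ∀ i, IsZeroMode t (Γ i)
  anticommutator : ∀ i j, Γ i * Γ j + Γ j * Γ i = if i = j then 2 else 0
  complete : ∀ Γ' : Op Λ, IsZeroMode t Γ' → ∃ a : Fin k → ℝ, Γ' = ∑ i, (a i : ℂ) • Γ i

/-- The mode is localized near the origin with (exact) localization length `ξ ≥ 0`: its amplitude at
site `n` is `O(exp (-|n| / ξ'))` for every `ξ' > ξ` and for no positive `ξ' < ξ`. -/
def HasLocalizationLength (Γ : Op Λ) (ξ : ℝ) : Prop :=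
  0 ≤ ξ ∧ ∃ b b' : Λ → ℝ, HasExpansion Γ b b' ∧
    (∀ ξ', ξ < ξ' → ∃ C : ℝ, ∀ n : Λ, |b n| + |b' n| ≤ C * Real.exp (-|((n : ℤ) : ℝ)| / ξ')) ∧
    (∀ ξ', 0 < ξ' → ξ' < ξ →
      ¬ ∃ C : ℝ, ∀ n : Λ, |b n| + |b' n| ≤ C * Real.exp (-|((n : ℤ) : ℝ)| / ξ'))

/-- The half-infinite chain with a left boundary: sites `1, 2, 3, …`. -/
def leftEdge : Set ℤ := Set.Ici 1

/-- The half-infinite chain with a right boundary: sites `…, -3, -2, -1`. -/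
def rightEdge : Set ℤ := Set.Iic (-1)

end BDI

end

/-!
A combination `Γ = ∑ (b_n γ_n + b'_n γ̃_n)` commutes with the bonds exactly when `b` and `b'` are
annihilated by two Toeplitz operators of the half line. This follows from the canonical
anticommutation relations (`majorana_anticomm`): they turn commutators with bonds into combinations of
single Majorana operators, identify the operator norm of a real combination with the `ℓ²` norm of its
coefficients, and show that a norm-convergent combination which anticommutes with all Majorana
operators squares to zero (`commutesWithHamiltonian_iff`). Numbering the sites from the boundary, the
symbol of these Toeplitz operators is `f(z)` or `f(1 / z)`, depending on the side of the boundary and on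
the kind of Majorana operator.

An amplitude sequence preceded by `N_p` zeros lies in the kernel for `f` exactly when it solves the
linear recurrence whose characteristic polynomial is the numerator `z ^ N_p * f(z)`
(`inToeplitzKernel_iff`). Among the solutions of a recurrence, those which are `o(s ^ n)` are the
solutions of the recurrence given by the roots of modulus less than `s` (`exists_factor_edgeSpace`);
this monic recurrence has arbitrary initial values, and the `N_p` leading zeros fix `N_p` of them. Hence
the kernel elements that are `o(s ^ n)`, for `s ≤ 1`, form a space of dimension `max (N(s) - N_p) 0`, where
`N(s)` counts the zeros with `|z| < s` (`finrank_edgeSpace`). For `s = 1` this is `max ω 0`. The spaces for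
different `s` form a flag, and an orthonormal basis adapted to it (`exists_orthonormal_adapted`) realizes
the decay rates of the `ω` largest zeros (`exists_toeplitzKernel_basis`).

For `f(1 / z)` the zeros inside the disk are the inverses of the zeros of `f` outside it, infinity
included, and the invariant is `-(ω + 2c)` (`zerosInside_reflect`, `omega_reflect`). So at most one of the
two kernels is nontrivial, and the signs of `ω` and `ω + 2c` separate the three cases.
-/

noncomputable section

namespace BDI

/-! ### Majorana operators and their anticommutation relations -/

section

variable {Λ : Set ℤ}

open scoped symmDiff

theorem annihilation_apply (n : Λ) (ψ : Fock Λ) (S : Finset Λ) :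
    annihilation n ψ S = if n ∈ S then 0 else fermiSign n S * ψ (insert n S) := rfl

theorem star_fermiSign (n : Λ) (S : Finset Λ) : star (fermiSign n S) = fermiSign n S := by
  simp [fermiSign]

theorem fermiSign_mul_self (n : Λ) (S : Finset Λ) : fermiSign n S * fermiSign n S = 1 := by
  simp [fermiSign, ← mul_pow]

/-- Toggling the site `n` changes the sign of the sites beyond `n`; this is the source of the
anticommutation relations. -/
theorem fermiSign_symmDiff (n m : Λ) (S : Finset Λ) :
    fermiSign m (S ∆ {n}) = if n < m then -fermiSign m S else fermiSign m S := by
  by_cases hn : n ∈ S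
  · have h : S ∆ {n} = S.erase n := by ext k; simp [Finset.mem_symmDiff]; grind
    rw [h]
    have hS : fermiSign m S = fermiSign m (insert n (S.erase n)) := by rw [Finset.insert_erase hn]
    rw [hS]
    unfold fermiSign
    rw [Finset.filter_insert]
    split_ifs with h
    · rw [Finset.card_insert_of_notMem (by simp), pow_succ]; ring
    · rfl
  · have h : S ∆ {n} = insert n S := by ext k; simp [Finset.mem_symmDiff]; grind
    rw [h]
    unfold fermiSign
    rw [Finset.filter_insert]
    split_ifs with h
    · rw [Finset.card_insert_of_notMem (by simp [hn]), pow_succ]; ring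
    · rfl

theorem creation_apply (n : Λ) (ψ : Fock Λ) (S : Finset Λ) :
    creation n ψ S = if n ∈ S then fermiSign n S * ψ (S.erase n) else 0 := by
  have h1 : inner ℂ (lp.single 2 S (1 : ℂ) : Fock Λ) (creation n ψ) = creation n ψ S := by
    rw [lp.inner_single_left]; simp
  have h2 : annihilation n (lp.single 2 S (1 : ℂ) : Fock Λ) =
      if n ∈ S then fermiSign n S • (lp.single 2 (S.erase n) (1 : ℂ) : Fock Λ) else 0 := by
    ext R
    rw [annihilation_apply, lp.single_apply]
    by_cases hn : n ∈ S
    · by_cases hR : n ∈ R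
      · have : R ≠ S.erase n := fun h => by simp [h] at hR
        simp [hn, hR, this, lp.single_apply]
      · by_cases hRS : insert n R = S
        · subst hRS
          have : fermiSign n R = fermiSign n (insert n R) := by
            unfold fermiSign; rw [Finset.filter_insert, if_neg (lt_irrefl _)]
          simp [hR, this]
        · have : R ≠ S.erase n := fun h => hRS (by rw [h, Finset.insert_erase hn])
          simp [hR, hRS, hn, this, lp.single_apply]
    · have : insert n R ≠ S := fun h => hn (by simp [← h])
      simp [hn, this]
  rw [← h1, creation, ContinuousLinearMap.adjoint_inner_right, h2]
  split_ifs
  · rw [inner_smul_left, lp.inner_single_left]; simp [fermiSign]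
  · simp

/-- All Majorana operators in one family: `γ_n` is `majorana (true, n)` and `γ̃_n` is
`majorana (false, n)`. -/
def majorana (i : Bool × Λ) : Op Λ := if i.1 then gam i.2 else gamTilde i.2

/-- The phase by which the amplitudes of `γ_n` and `γ̃_n` differ. -/
def majoranaPhase (i : Bool × Λ) (S : Finset Λ) : ℂ :=
  if i.1 then 1 else if i.2 ∈ S then Complex.I else -Complex.I

/-- Both kinds of Majorana operators toggle the occupation of their site. -/
theorem majorana_apply (i : Bool × Λ) (ψ : Fock Λ) (S : Finset Λ) :
    majorana i ψ S = majoranaPhase i S * fermiSign i.2 S * ψ (S ∆ {i.2}) := by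
  obtain ⟨σ, n⟩ := i
  have h : ∀ S : Finset Λ, S ∆ {n} = if n ∈ S then S.erase n else insert n S := by
    intro S; ext k; split_ifs <;> simp [Finset.mem_symmDiff] <;> grind
  cases σ
  · change Complex.I * (creation n ψ S - annihilation n ψ S) = _
    by_cases hn : n ∈ S <;>
      simp [majoranaPhase, creation_apply, annihilation_apply, h, hn, mul_assoc]
  · by_cases hn : n ∈ S <;>
      simp [majorana, majoranaPhase, gam, creation_apply, annihilation_apply, h, hn]

theorem majoranaPhase_same_site (σ τ : Bool) (n : Λ) (S : Finset Λ) :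
    majoranaPhase (σ, n) S * majoranaPhase (τ, n) (S ∆ {n}) +
      majoranaPhase (τ, n) S * majoranaPhase (σ, n) (S ∆ {n}) = if σ = τ then 2 else 0 := by
  by_cases hn : n ∈ S <;> cases σ <;> cases τ <;>
    simp [majoranaPhase, hn, Finset.mem_symmDiff, one_add_one_eq_two]

theorem majoranaPhase_symmDiff_of_ne (τ : Bool) {n m : Λ} (h : n ≠ m) (S : Finset Λ) :
    majoranaPhase (τ, m) (S ∆ {n}) = majoranaPhase (τ, m) S := by
  have : m ∈ S ∆ {n} ↔ m ∈ S := by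
    rw [Finset.mem_symmDiff, Finset.mem_singleton]
    have := h.symm
    tauto
  simp only [majoranaPhase, this]

/-- The canonical anticommutation relations of the Majorana operators. -/
theorem majorana_anticomm (i j : Bool × Λ) :
    majorana i * majorana j + majorana j * majorana i = if i = j then 2 else 0 := by
  ext ψ S
  have key : (majorana i * majorana j + majorana j * majorana i) ψ S =
      majorana i (majorana j ψ) S + majorana j (majorana i ψ) S := rfl
  rw [key]
  obtain ⟨σ, n⟩ := i
  obtain ⟨τ, m⟩ := j
  simp only [majorana_apply, fermiSign_symmDiff]
  by_cases hnm : n = m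
  · subst hnm
    have h2 : ((if (σ, n) = (τ, n) then 2 else 0 : Op Λ) ψ) S =
        (if σ = τ then 2 else 0) * ψ S := by
      have h2 : ((2 : Op Λ) ψ) S = 2 * ψ S := by
        have : (2 : Op Λ) = (1 : Op Λ) + 1 := one_add_one_eq_two.symm
        rw [this, two_mul]
        rfl
      by_cases h : σ = τ
      · simp only [h, if_true, h2]
      · simp [h]
    rw [h2, ← majoranaPhase_same_site σ τ n S, if_neg (lt_irrefl n),
      symmDiff_symmDiff_cancel_right]
    linear_combination ((majoranaPhase (σ, n) S * majoranaPhase (τ, n) (S ∆ {n}) +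
      majoranaPhase (τ, n) S * majoranaPhase (σ, n) (S ∆ {n})) * ψ S) * fermiSign_mul_self n S
  · have hc : S ∆ {m} ∆ {n} = S ∆ {n} ∆ {m} := by
      rw [symmDiff_right_comm]
    have hne : ((σ, n) : Bool × Λ) ≠ (τ, m) := fun h => hnm (Prod.mk.inj h).2
    rw [if_neg hne, majoranaPhase_symmDiff_of_ne τ hnm,
      majoranaPhase_symmDiff_of_ne σ (Ne.symm hnm), hc]
    change _ = (0 : ℂ)
    rcases lt_or_gt_of_ne hnm with h | h
    · rw [if_pos h, if_neg h.not_gt]; ring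
    · rw [if_pos h, if_neg h.not_gt]; ring

theorem isSelfAdjoint_majorana (i : Bool × Λ) : IsSelfAdjoint (majorana i) := by
  obtain ⟨σ, n⟩ := i
  have h : star (annihilation n) = creation n := rfl
  have h' : star (creation n) = annihilation n := by rw [← h, star_star]
  cases σ
  · simp [majorana, gamTilde, IsSelfAdjoint, h, h']
    rw [← smul_neg, neg_sub]
  · simp [majorana, gam, IsSelfAdjoint, h, h', add_comm]

/-- Time reversal fixes every `γ_n` and changes the sign of every `γ̃_n`. -/
theorem timeReversal_majorana (i : Bool × Λ) (ψ : Fock Λ) :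
    timeReversal (majorana i (timeReversal ψ)) = if i.1 then majorana i ψ else -majorana i ψ := by
  obtain ⟨σ, n⟩ := i
  ext S
  have hs := star_fermiSign n S
  simp only [Complex.star_def] at hs
  have : ∀ ψ : Fock Λ, (timeReversal ψ) S = star (ψ S) := fun _ => rfl
  have h2 : ∀ ψ : Fock Λ, (timeReversal ψ) (S ∆ {n}) = star (ψ (S ∆ {n})) := fun _ => rfl
  rw [this, majorana_apply]
  cases σ <;> by_cases hn : n ∈ S <;>
    simp [majorana_apply, h2, majoranaPhase, hn, hs]

end

/-! ### Zero modes and Toeplitz kernels -/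

section

variable {Λ : Set ℤ}

instance : Nontrivial (Op Λ) :=
  haveI : Nontrivial (Fock Λ) := ⟨⟨lp.single 2 ∅ (1 : ℂ), 0, fun h => by
    have := congrArg (fun ψ : Fock Λ => ψ ∅) h
    simp at this⟩⟩
  inferInstance

theorem majorana_anticomm_smul (i j : Bool × Λ) (a : ℂ) :
    (a • majorana i) * majorana j + majorana j * (a • majorana i) =
      algebraMap ℂ (Op Λ) (if i = j then 2 * a else 0) := by
  rw [smul_mul_assoc, mul_smul_comm, ← smul_add, majorana_anticomm]
  split_ifs
  · rw [Algebra.algebraMap_eq_smul_one, mul_comm, mul_smul, ← one_add_one_eq_two (R := Op Λ),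
      ← two_smul ℂ (1 : Op Λ)]
  · simp

/-- The anticommutation relations make the operator norm of a real combination of distinct Majorana
operators equal to the Euclidean norm of its coefficients. -/
theorem norm_sum_majorana_sq {J : Type*} {u : J → Bool × Λ} (hu : Function.Injective u)
    (a : J → ℝ) (s : Finset J) :
    ‖∑ j ∈ s, (a j : ℂ) • majorana (u j)‖ ^ 2 = ∑ j ∈ s, a j ^ 2 := by
  classical
  obtain ⟨X, hX⟩ : ∃ X, X = ∑ j ∈ s, (a j : ℂ) • majorana (u j) := ⟨_, rfl⟩
  rw [← hX]
  have hsa : IsSelfAdjoint X := by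
    rw [hX]
    refine isSelfAdjoint_sum _ fun j _ => ?_
    refine IsSelfAdjoint.smul ?_ (isSelfAdjoint_majorana _)
    simp [IsSelfAdjoint]
  have h2 : X * X + X * X = algebraMap ℂ (Op Λ) (2 * (∑ j ∈ s, a j ^ 2 : ℝ)) := by
    have h3 : ∀ j ∈ s, X * majorana (u j) + majorana (u j) * X =
        algebraMap ℂ (Op Λ) (2 * a j) := by
      intro j hj
      rw [hX, Finset.sum_mul, Finset.mul_sum, ← Finset.sum_add_distrib]
      simp only [majorana_anticomm_smul, hu.eq_iff]
      rw [← map_sum, Finset.sum_ite_eq' s j, if_pos hj]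
    calc X * X + X * X = ∑ j ∈ s, (a j : ℂ) • (X * majorana (u j) + majorana (u j) * X) := by
          rw [show X * X + X * X = X * (∑ j ∈ s, (a j : ℂ) • majorana (u j)) +
            (∑ j ∈ s, (a j : ℂ) • majorana (u j)) * X by rw [← hX],
            Finset.sum_mul, Finset.mul_sum, ← Finset.sum_add_distrib]
          refine Finset.sum_congr rfl fun j _ => ?_
          rw [smul_mul_assoc, mul_smul_comm, smul_add]
      _ = _ := by
          rw [Finset.sum_congr rfl fun j hj => by rw [h3 j hj]]
          simp only [Algebra.algebraMap_eq_smul_one, smul_smul]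
          rw [← Finset.sum_smul]
          congr 1
          push_cast
          rw [Finset.mul_sum]
          exact Finset.sum_congr rfl fun j _ => by ring
  have h4 : X * X = algebraMap ℂ (Op Λ) ((∑ j ∈ s, a j ^ 2 : ℝ) : ℂ) := by
    rw [← two_smul ℂ, map_mul, ← smul_eq_mul, Algebra.algebraMap_eq_smul_one 2, smul_mul_assoc,
      one_mul] at h2
    exact smul_right_injective _ (two_ne_zero (α := ℂ)) h2
  have h5 : ‖X * X‖ = ‖X‖ ^ 2 := by
    have := CStarRing.norm_star_mul_self (x := X)
    rw [hsa.star_eq] at this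
    rw [this, sq]
  rw [← h5, h4, norm_algebraMap', Complex.norm_real, Real.norm_of_nonneg]
  exact Finset.sum_nonneg fun j _ => sq_nonneg _

theorem summable_majorana {J : Type*} {u : J → Bool × Λ} (hu : Function.Injective u)
    {a : J → ℝ} (ha : Summable fun j => a j ^ 2) :
    Summable fun j => (a j : ℂ) • majorana (u j) := by
  rw [summable_iff_vanishing_norm]
  intro ε hε
  obtain ⟨s, hs⟩ := summable_iff_vanishing_norm.1 ha (ε ^ 2) (by positivity)
  refine ⟨s, fun r hr => ?_⟩
  have h := hs r hr
  rw [← norm_sum_majorana_sq hu, Real.norm_of_nonneg (by positivity)] at h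
  exact lt_of_pow_lt_pow_left₀ 2 hε.le h

/-- The coefficients of a mode are its anticommutators with the Majorana operators. -/
theorem HasExpansion.anticomm {Γ : Op Λ} {b b' : Λ → ℝ} (h : HasExpansion Γ b b') (i : Bool × Λ) :
    Γ * majorana i + majorana i * Γ =
      algebraMap ℂ (Op Λ) (2 * ((if i.1 then b i.2 else b' i.2 : ℝ) : ℂ)) := by
  have h1 := (h.mul_right (majorana i)).add (h.mul_left (majorana i))
  refine h1.unique ?_
  have h2 : ∀ n : Λ, ((b n : ℂ) • gam n + (b' n : ℂ) • gamTilde n) * majorana i +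
      majorana i * ((b n : ℂ) • gam n + (b' n : ℂ) • gamTilde n) =
      algebraMap ℂ (Op Λ) (if n = i.2 then 2 * ((if i.1 then b i.2 else b' i.2 : ℝ) : ℂ) else 0) := by
    intro n
    have e1 := majorana_anticomm_smul (true, n) i (b n)
    have e2 := majorana_anticomm_smul (false, n) i (b' n)
    have e3 : ∀ x y z : Op Λ, (x + y) * z + z * (x + y) = (x * z + z * x) + (y * z + z * y) := by
      intros; noncomm_ring
    change ((b n : ℂ) • majorana (true, n) + (b' n : ℂ) • majorana (false, n)) * majorana i +
      majorana i * ((b n : ℂ) • majorana (true, n) + (b' n : ℂ) • majorana (false, n)) = _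
    rw [e3, e1, e2, ← map_add]
    congr 1
    obtain ⟨σ, m⟩ := i
    by_cases hnm : n = m
    · subst hnm; cases σ <;> simp
    · simp [hnm]
  simp only [h2]
  have h3 := hasSum_single (f := fun n : Λ => algebraMap ℂ (Op Λ)
    (if n = i.2 then 2 * ((if i.1 then b i.2 else b' i.2 : ℝ) : ℂ) else 0)) i.2
    fun n hn => by rw [if_neg hn, map_zero]
  rwa [if_pos rfl] at h3

/-- A norm-convergent real combination of Majorana operators has square-summable coefficients. -/
theorem HasExpansion.summable_sq {Γ : Op Λ} {b b' : Λ → ℝ} (h : HasExpansion Γ b b') :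
    (Summable fun n => b n ^ 2) ∧ Summable fun n => b' n ^ 2 := by
  classical
  have hnorm : ∀ s : Finset Λ, ‖∑ n ∈ s, ((b n : ℂ) • gam n + (b' n : ℂ) • gamTilde n)‖ ^ 2 =
      ∑ n ∈ s, (b n ^ 2 + b' n ^ 2) := by
    intro s
    have := norm_sum_majorana_sq (u := (id : Bool × Λ → Bool × Λ)) Function.injective_id
      (fun i => if i.1 then b i.2 else b' i.2) ((Finset.univ : Finset Bool) ×ˢ s)
    rw [Finset.sum_product_right, Finset.sum_product_right] at this
    simpa [majorana] using this
  have hsum : Summable fun n => b n ^ 2 + b' n ^ 2 := by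
    rw [summable_iff_vanishing_norm]
    intro ε hε
    obtain ⟨s, hs⟩ := summable_iff_vanishing_norm.1 h.summable (Real.sqrt ε) (by positivity)
    refine ⟨s, fun r hr => ?_⟩
    rw [← hnorm, Real.norm_of_nonneg (by positivity)]
    exact (Real.lt_sqrt (norm_nonneg _)).1 (hs r hr)
  exact ⟨hsum.of_nonneg_of_le (fun n => sq_nonneg _) fun n => by linarith [sq_nonneg (b' n)],
    hsum.of_nonneg_of_le (fun n => sq_nonneg _) fun n => by linarith [sq_nonneg (b n)]⟩

/-- The commutator of a mode with a bond, up to the factor `i`. -/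
def bondFlow (t : ℤ →₀ ℝ) (b b' : Λ → ℝ) (p : Λ × Λ) : Op Λ :=
  ((t ((p.2 : ℤ) - p.1) * b' p.1 : ℝ) : ℂ) • majorana (true, p.2) -
    ((t ((p.2 : ℤ) - p.1) * b p.2 : ℝ) : ℂ) • majorana (false, p.1)

theorem HasExpansion.commutator_bond {Γ : Op Λ} {b b' : Λ → ℝ} (h : HasExpansion Γ b b')
    (t : ℤ →₀ ℝ) (p : Λ × Λ) :
    Γ * bond t p - bond t p * Γ = Complex.I • bondFlow t b b' p := by
  have h1 := h.anticomm (false, p.1)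
  have h2 := h.anticomm (true, p.2)
  set G := majorana (true, p.2) with hG
  set G' := majorana (false, p.1) with hG'
  have e : Γ * (G' * G) - (G' * G) * Γ = (Γ * G' + G' * Γ) * G - G' * (Γ * G + G * Γ) := by
    noncomm_ring
  have hb : bond t p = ((Complex.I / 2) * (t ((p.2 : ℤ) - p.1) : ℂ)) • (G' * G) := rfl
  rw [hb, mul_smul_comm, smul_mul_assoc, ← smul_sub, e, h1, h2, bondFlow, ← hG, ← hG',
    Algebra.algebraMap_eq_smul_one, Algebra.algebraMap_eq_smul_one, smul_mul_assoc, one_mul,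
    mul_smul_comm, mul_one, smul_sub, smul_sub, smul_smul, smul_smul, smul_smul, smul_smul]
  congr 2 <;> simp <;> ring

/-- A norm-convergent sum of self-adjoint operators that anticommutes with each of its terms
squares to zero, so that it vanishes. -/
theorem eq_zero_of_hasSum_of_anticomm {J : Type*} {F : J → Op Λ} {X : Op Λ} (h : HasSum F X)
    (hF : ∀ j, IsSelfAdjoint (F j)) (hX : ∀ j, X * F j + F j * X = 0) : X = 0 := by
  have h1 := (h.mul_left X).add (h.mul_right X)
  simp only [hX] at h1
  have h2 : X * X + X * X = 0 := h1.unique hasSum_zero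
  have h3 : X * X = 0 := by
    rw [← two_smul ℂ] at h2
    exact (smul_eq_zero.1 h2).resolve_left two_ne_zero
  have h4 : star X = X := by
    have := h.star
    simp only [fun j => (hF j).star_eq] at this
    exact this.unique h
  rw [← CStarRing.star_mul_self_eq_zero_iff, h4, h3]

/-- On each of the finitely many diagonals on which `t` does not vanish, the sum is one over distinct
Majorana operators with square-summable coefficients. -/
theorem summable_bonds (t : ℤ →₀ ℝ) (σ : Bool) {x : Λ → ℝ} (hx : Summable fun n => x n ^ 2)
    {π ρ : Λ × Λ → Λ}
    (hπ : ∀ p q : Λ × Λ, (p.2 : ℤ) - p.1 = (q.2 : ℤ) - q.1 → π p = π q → p = q)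
    (hρ : ∀ p q : Λ × Λ, (p.2 : ℤ) - p.1 = (q.2 : ℤ) - q.1 → ρ p = ρ q → p = q) :
    Summable fun p : Λ × Λ =>
      ((t ((p.2 : ℤ) - p.1) * x (π p) : ℝ) : ℂ) • majorana (σ, ρ p) := by
  classical
  have h1 : ∀ α : ℤ, Summable ({p : Λ × Λ | (p.2 : ℤ) - p.1 = α}.indicator fun p =>
      ((t ((p.2 : ℤ) - p.1) * x (π p) : ℝ) : ℂ) • majorana (σ, ρ p)) := by
    intro α
    rw [← summable_subtype_iff_indicator]
    refine summable_majorana (u := fun p : {p : Λ × Λ | (p.2 : ℤ) - p.1 = α} => (σ, ρ p))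
      (a := fun p : {p : Λ × Λ | (p.2 : ℤ) - p.1 = α} =>
        t (((p : Λ × Λ).2 : ℤ) - (p : Λ × Λ).1) * x (π p)) ?_ ?_
    · intro p q h
      exact Subtype.ext (hρ _ _ (p.2.trans q.2.symm) (Prod.mk.inj h).2)
    · have h2 : Summable fun p : {p : Λ × Λ | (p.2 : ℤ) - p.1 = α} => t α ^ 2 * x (π p) ^ 2 :=
        (hx.comp_injective (i := fun p : {p : Λ × Λ | (p.2 : ℤ) - p.1 = α} => π p)
          fun p q h => Subtype.ext (hπ _ _ (p.2.trans q.2.symm) h)).mul_left _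
      refine h2.congr fun p => ?_
      rw [show ((p : Λ × Λ).2 : ℤ) - (p : Λ × Λ).1 = α from p.2]
      ring
  refine (summable_sum (s := t.support) fun α _ => h1 α).congr fun p => ?_
  simp only [Set.indicator_apply, Set.mem_ofPred_eq]
  rw [Finset.sum_ite_eq]
  split_ifs with h
  · rfl
  · rw [Finsupp.notMem_support_iff.1 h]; simp

theorem isSelfAdjoint_bondFlow (t : ℤ →₀ ℝ) (b b' : Λ → ℝ) (p : Λ × Λ) :
    IsSelfAdjoint (bondFlow t b b' p) :=
  IsSelfAdjoint.sub (IsSelfAdjoint.smul (by simp [IsSelfAdjoint]) (isSelfAdjoint_majorana _))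
    (IsSelfAdjoint.smul (by simp [IsSelfAdjoint]) (isSelfAdjoint_majorana _))

theorem bondFlow_anticomm (t : ℤ →₀ ℝ) (b b' : Λ → ℝ) (p : Λ × Λ) (i : Bool × Λ) :
    bondFlow t b b' p * majorana i + majorana i * bondFlow t b b' p =
      algebraMap ℂ (Op Λ) (((if i = (true, p.2) then 2 * (t ((p.2 : ℤ) - p.1) * b' p.1) else 0) -
        (if i = (false, p.1) then 2 * (t ((p.2 : ℤ) - p.1) * b p.2) else 0) : ℝ) : ℂ) := by
  have e : ∀ x y z : Op Λ, (x - y) * z + z * (x - y) = (x * z + z * x) - (y * z + z * y) := by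
    intros; noncomm_ring
  rw [bondFlow, e, majorana_anticomm_smul, majorana_anticomm_smul, ← map_sub]
  congr 1
  simp only [eq_comm (a := i)]
  push_cast
  split_ifs <;> simp

theorem hasSum_algebraMap {J : Type*} {f : J → ℝ} {x : ℝ} :
    HasSum (fun j => algebraMap ℂ (Op Λ) (f j : ℂ)) (algebraMap ℂ (Op Λ) (x : ℂ)) ↔
      HasSum f x := by
  have h := (algebraMap_isometry ℂ (Op Λ)).isUniformInducing.isInducing
  have := h.hasSum_iff (L := .unconditional J) (f := fun j => (f j : ℂ)) (a := (x : ℂ)) (g := algebraMap ℂ (Op Λ))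
  rw [← Complex.hasSum_ofReal, ← this]
  rfl

/-- The zero modes of the chain decouple into two families of coefficients, each in the kernel of a
Toeplitz operator. -/
theorem commutesWithHamiltonian_iff {t : ℤ →₀ ℝ} {Γ : Op Λ} {b b' : Λ → ℝ}
    (h : HasExpansion Γ b b') :
    CommutesWithHamiltonian t Γ ↔
      (∀ n : Λ, HasSum (fun m : Λ => t (m - n) * b m) 0) ∧
      (∀ m : Λ, HasSum (fun n : Λ => t (m - n) * b' n) 0) := by
  have hG : CommutesWithHamiltonian t Γ ↔ HasSum (bondFlow t b b') 0 := by
    unfold CommutesWithHamiltonian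
    simp only [h.commutator_bond]
    constructor <;> intro h0
    · simpa [smul_smul] using h0.const_smul (-Complex.I)
    · simpa using h0.const_smul Complex.I
  have hcomm : ∀ X : Op Λ, HasSum (bondFlow t b b') X → ∀ (i : Bool × Λ) (g : Λ → ℝ)
      (e : Λ → Λ × Λ), Function.Injective e → (∀ n, (((if i = (true, (e n).2) then
        2 * (t (((e n).2 : ℤ) - (e n).1) * b' (e n).1) else 0) -
        (if i = (false, (e n).1) then 2 * (t (((e n).2 : ℤ) - (e n).1) * b (e n).2) else 0) : ℝ)) =
        (if i.1 then 2 else -2) * g n) →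
      (∀ p, p ∉ Set.range e → i ≠ (true, p.2) ∧ i ≠ (false, p.1)) →
      (X * majorana i + majorana i * X = 0 ↔ HasSum g 0) := by
    intro X hX i g e he hg hout
    have h1 := (hX.mul_right (majorana i)).add (hX.mul_left (majorana i))
    simp only [bondFlow_anticomm] at h1
    have h2 : X * majorana i + majorana i * X = 0 ↔ HasSum (fun p : Λ × Λ =>
        algebraMap ℂ (Op Λ) (((if i = (true, p.2) then 2 * (t ((p.2 : ℤ) - p.1) * b' p.1) else 0) -
        (if i = (false, p.1) then 2 * (t ((p.2 : ℤ) - p.1) * b p.2) else 0) : ℝ) : ℂ))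
        (algebraMap ℂ (Op Λ) ((0 : ℝ) : ℂ)) := by
      rw [Complex.ofReal_zero, map_zero]
      exact ⟨fun h => h ▸ h1, fun h => h1.unique h⟩
    rw [h2, hasSum_algebraMap, ← he.hasSum_iff]
    · simp only [Function.comp_def, hg]
      have h3 : (if i.1 then (2 : ℝ) else -2) ≠ 0 := by split_ifs <;> norm_num
      simpa using hasSum_mul_left_iff (f := g) (a₁ := 0) h3
    · intro p hp
      simp [hout p hp]
  have hβ : ∀ X : Op Λ, HasSum (bondFlow t b b') X → ∀ m : Λ,
      (X * majorana (true, m) + majorana (true, m) * X = 0 ↔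
        HasSum (fun n : Λ => t (m - n) * b' n) 0) := by
    intro X hX m
    refine hcomm X hX (true, m) _ (fun n => (n, m)) (fun _ _ h => (Prod.mk.inj h).1)
      (fun n => by simp) ?_
    rintro ⟨p, q⟩ hp
    exact ⟨fun h => hp ⟨p, by rw [(Prod.mk.inj h).2]⟩, by simp⟩
  have hα : ∀ X : Op Λ, HasSum (bondFlow t b b') X → ∀ n : Λ,
      (X * majorana (false, n) + majorana (false, n) * X = 0 ↔
        HasSum (fun m : Λ => t (m - n) * b m) 0) := by
    intro X hX n
    refine hcomm X hX (false, n) _ (fun m => (n, m)) (fun _ _ h => (Prod.mk.inj h).2)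
      (fun m => by simp) ?_
    rintro ⟨p, q⟩ hp
    exact ⟨by simp, fun h => hp ⟨q, by rw [(Prod.mk.inj h).2]⟩⟩
  rw [hG]
  constructor
  · intro h0
    exact ⟨fun n => (hα 0 h0 n).1 (by simp), fun m => (hβ 0 h0 m).1 (by simp)⟩
  · rintro ⟨h1, h2⟩
    have hs := h.summable_sq
    have hsum : Summable (bondFlow t b b') := by
      refine (summable_bonds t true hs.2 (π := Prod.fst) (ρ := Prod.snd) ?_ ?_).sub
        (summable_bonds t false hs.1 (π := Prod.snd) (ρ := Prod.fst) ?_ ?_)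
      all_goals
        rintro ⟨p, p'⟩ ⟨q, q'⟩ h0 h1
        simp only [Prod.mk.injEq, Subtype.ext_iff] at h0 h1 ⊢
        omega
    obtain ⟨X, hX⟩ := hsum
    have hXm : ∀ i, X * majorana i + majorana i * X = 0 := by
      rintro ⟨σ, n⟩
      cases σ
      · exact (hα X hX n).2 (h1 n)
      · exact (hβ X hX n).2 (h2 n)
    -- The sum exists, and its vanishing anticommutators with all Majorana operators force it to be zero.
    have hX0 : X = 0 := by
      refine eq_zero_of_hasSum_of_anticomm hX (isSelfAdjoint_bondFlow t b b') fun p => ?_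
      have e : ∀ (x y z : Op Λ) (a c : ℂ), z * (a • x - c • y) + (a • x - c • y) * z =
          a • (z * x + x * z) - c • (z * y + y * z) := by
        intros
        simp only [mul_sub, sub_mul, mul_smul_comm, smul_mul_assoc, smul_add]
        abel
      rw [bondFlow, e, hXm, hXm]
      simp
    exact hX0 ▸ hX

end

/-! ### Growth of the solutions of linear recurrences -/

section

open Polynomial Filter Topology

/-- The recurrence operator `A(L)`, where `L` is the left shift of sequences. -/
def recurrence {R : Type*} [CommRing R] (A : R[X]) : (ℕ → R) →ₗ[R] (ℕ → R) :=
  aeval (LinearMap.funLeft R R Nat.succ) A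

section
variable {R : Type*} [CommRing R]

theorem recurrence_mul (A B : R[X]) (β : ℕ → R) :
    recurrence (A * B) β = recurrence A (recurrence B β) := by
  simp [recurrence]

theorem recurrence_monomial_apply (k : ℕ) (a : R) (β : ℕ → R) (n : ℕ) :
    recurrence (monomial k a) β n = a * β (n + k) := by
  have h : ∀ (k : ℕ) (n : ℕ), ((LinearMap.funLeft R R Nat.succ) ^ k) β n = β (n + k) := by
    intro k
    induction k with
    | zero => intro n; rfl
    | succ k ih =>
      intro n
      rw [pow_succ', Module.End.mul_apply, LinearMap.funLeft_apply, ih]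
      congr 1
      omega
  rw [recurrence, aeval_monomial, Module.End.mul_apply, Module.algebraMap_end_apply, Pi.smul_apply,
    h, smul_eq_mul]

theorem recurrence_apply (A : R[X]) (β : ℕ → R) (n : ℕ) :
    recurrence A β n = ∑ k ∈ Finset.range (A.natDegree + 1), A.coeff k * β (n + k) := by
  conv_lhs => rw [A.as_sum_range]
  rw [recurrence, map_sum, LinearMap.sum_apply, Finset.sum_apply]
  exact Finset.sum_congr rfl fun k _ => recurrence_monomial_apply k _ β n

theorem recurrence_X_sub_C_apply (z : R) (β : ℕ → R) (n : ℕ) :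
    recurrence (X - C z) β n = β (n + 1) - z * β n := by
  have h1 := recurrence_monomial_apply 1 1 β n
  have h2 := recurrence_monomial_apply 0 z β n
  rw [monomial_one_one_eq_X] at h1
  rw [monomial_zero_left] at h2
  rw [recurrence] at h1 h2 ⊢
  rw [map_sub, LinearMap.sub_apply, Pi.sub_apply, h1, h2]
  simp

theorem recurrence_C_apply (z : R) (β : ℕ → R) : recurrence (C z) β = z • β := by
  simp [recurrence, Module.algebraMap_end_apply]

end

theorem recurrence_ofReal (A : ℝ[X]) (β : ℕ → ℝ) (n : ℕ) :
    recurrence (A.map Complex.ofRealHom) (fun k => (β k : ℂ)) n = (recurrence A β n : ℂ) := by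
  rw [recurrence_apply, recurrence_apply, natDegree_map]
  push_cast
  simp

/-- The first-order case: the homogeneous solution decays faster than the inhomogeneity. -/
theorem exists_bound_of_recurrence_X_sub_C {z : ℂ} {s : ℝ} (hz : ‖z‖ < s) {β : ℕ → ℂ}
    (h : ∃ K, ∀ n, ‖recurrence (X - C z) β n‖ ≤ K * s ^ n) : ∃ K, ∀ n, ‖β n‖ ≤ K * s ^ n := by
  obtain ⟨K, hK⟩ := h
  have hs : 0 < s := (norm_nonneg z).trans_lt hz
  have hd : 0 < s - ‖z‖ := sub_pos.2 hz
  refine ⟨max ‖β 0‖ (K / (s - ‖z‖)), fun n => ?_⟩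
  set M := max ‖β 0‖ (K / (s - ‖z‖)) with hM
  have hM1 : K ≤ M * (s - ‖z‖) := (div_le_iff₀ hd).1 (le_max_right _ _)
  induction n with
  | zero => simp [hM]
  | succ n ih =>
    have h1 := hK n
    rw [recurrence_X_sub_C_apply] at h1
    have hp : 0 < s ^ n := pow_pos hs n
    calc ‖β (n + 1)‖ = ‖(β (n + 1) - z * β n) + z * β n‖ := by rw [sub_add_cancel]
      _ ≤ ‖β (n + 1) - z * β n‖ + ‖z‖ * ‖β n‖ := by rw [← norm_mul]; exact norm_add_le _ _
      _ ≤ K * s ^ n + ‖z‖ * (M * s ^ n) :=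
        add_le_add h1 (mul_le_mul_of_nonneg_left ih (norm_nonneg z))
      _ ≤ M * (s - ‖z‖) * s ^ n + ‖z‖ * (M * s ^ n) := by gcongr
      _ = M * s ^ (n + 1) := by ring

/-- A solution all of whose characteristic roots have modulus less than `s` is `O(s ^ n)`. -/
theorem exists_bound_of_recurrence_eq_zero {S : Multiset ℂ} {s : ℝ} (hS : ∀ z ∈ S, ‖z‖ < s)
    {β : ℕ → ℂ} (h : recurrence (S.map fun z => X - C z).prod β = 0) :
    ∃ K, ∀ n, ‖β n‖ ≤ K * s ^ n := by
  suffices h' : ∀ β : ℕ → ℂ,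
      (∃ K, ∀ n, ‖recurrence (S.map fun z => X - C z).prod β n‖ ≤ K * s ^ n) →
      ∃ K, ∀ n, ‖β n‖ ≤ K * s ^ n from h' β ⟨0, fun n => by simp [h]⟩
  clear h
  induction S using Multiset.induction with
  | empty =>
    intro β h
    simpa [recurrence] using h
  | cons z S ih =>
    intro β h
    rw [Multiset.map_cons, Multiset.prod_cons, mul_comm] at h
    simp only [recurrence_mul] at h
    exact exists_bound_of_recurrence_X_sub_C (hS z (Multiset.mem_cons_self z S))
      (ih (fun w hw => hS w (Multiset.mem_cons_of_mem hw)) _ h)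

/-- A solution all of whose characteristic roots have modulus at least `s` is not `o(s ^ n)` unless
it vanishes. -/
theorem eq_zero_of_isLittleO_of_recurrence {S : Multiset ℂ} {s : ℝ} (hs : 0 < s)
    (hS : ∀ z ∈ S, s ≤ ‖z‖) {β : ℕ → ℂ} (hβ : Tendsto (fun n => β n / (s : ℂ) ^ n) atTop (𝓝 0))
    (h : recurrence (S.map fun z => X - C z).prod β = 0) : β = 0 := by
  have hs' : (s : ℂ) ≠ 0 := by exact_mod_cast hs.ne'
  induction S using Multiset.induction generalizing β with
  | empty => simpa [recurrence] using h
  | cons z S ih =>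
    rw [Multiset.map_cons, Multiset.prod_cons, mul_comm, recurrence_mul] at h
    have h1 : recurrence (X - C z) β = 0 := by
      refine ih (fun w hw => hS w (Multiset.mem_cons_of_mem hw)) ?_ h
      have h2 := (((tendsto_add_atTop_iff_nat 1).2 hβ).const_mul (s : ℂ)).sub (hβ.const_mul z)
      simp only [mul_zero, sub_zero] at h2
      refine h2.congr fun n => ?_
      rw [recurrence_X_sub_C_apply, pow_succ]
      field_simp
    have h2 : ∀ n, β n = z ^ n * β 0 := by
      intro n
      induction n with
      | zero => simp
      | succ n ihn =>
        have := congrFun h1 n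
        rw [recurrence_X_sub_C_apply, Pi.zero_apply, sub_eq_zero] at this
        rw [this, ihn]; ring
    have hz := hS z (Multiset.mem_cons_self z S)
    have h3 : ∀ n, ‖β 0‖ ≤ ‖β n / (s : ℂ) ^ n‖ := by
      intro n
      rw [h2 n, norm_div, norm_mul, norm_pow, norm_pow, Complex.norm_real, Real.norm_of_nonneg hs.le,
        le_div_iff₀ (pow_pos hs n), mul_comm]
      gcongr
    have h4 : ‖β 0‖ ≤ 0 := ge_of_tendsto' (by simpa using hβ.norm) h3
    have h5 : β 0 = 0 := norm_le_zero_iff.1 h4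
    funext n
    rw [h2 n, h5, mul_zero, Pi.zero_apply]

theorem eq_zero_of_monic_recurrence {A : ℝ[X]} (hA : A.Monic) {β : ℕ → ℝ}
    (h : recurrence A β = 0) (h0 : ∀ k < A.natDegree, β k = 0) : β = 0 := by
  funext n
  induction n using Nat.strong_induction_on with
  | _ n ih =>
    by_cases hn : n < A.natDegree
    · exact h0 n hn
    · have h1 := congrFun h (n - A.natDegree)
      rw [recurrence_apply, Finset.sum_range_succ, Finset.sum_eq_zero, hA.coeff_natDegree,
        Nat.sub_add_cancel (not_lt.1 hn)] at h1
      · simpa using h1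
      · intro k hk
        rw [ih _ (by have := Finset.mem_range.1 hk; omega)]; simp

theorem exists_monic_recurrence {A : ℝ[X]} (hA : A.Monic) (w : Fin A.natDegree → ℝ) :
    ∃ β : ℕ → ℝ, recurrence A β = 0 ∧ ∀ k : Fin A.natDegree, β k = w k := by
  let E : LinearRecurrence ℝ := ⟨A.natDegree, fun k => -A.coeff k⟩
  refine ⟨E.mkSol w, ?_, E.mkSol_eq_init w⟩
  funext n
  have h : E.mkSol w (n + A.natDegree) = ∑ k : Fin A.natDegree, -A.coeff k * E.mkSol w (n + k) :=
    E.is_sol_mkSol w n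
  rw [recurrence_apply, Finset.sum_range_succ, hA.coeff_natDegree, one_mul, h,
    ← Fin.sum_univ_eq_sum_range (fun k => A.coeff k * E.mkSol w (n + k)), ← Finset.sum_add_distrib]
  simp

/-- The roots of a real polynomial inside a disk centred at the origin, being stable under complex
conjugation, are the roots of a monic real factor. -/
theorem exists_factor_roots_lt (P : ℝ[X]) (hP : P ≠ 0) (s : ℝ) :
    ∃ A B : ℝ[X], P = B * A ∧ A.Monic ∧
      A.map Complex.ofRealHom =
        (((P.map Complex.ofRealHom).roots.filter fun z => ‖z‖ < s).map fun z => X - C z).prod ∧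
      ∀ z ∈ (B.map Complex.ofRealHom).roots, s ≤ ‖z‖ := by
  classical
  set Q := P.map Complex.ofRealHom with hQ
  have hQ0 : Q ≠ 0 := (Polynomial.map_ne_zero_iff Complex.ofRealHom.injective).2 hP
  set S := Q.roots.filter fun z => ‖z‖ < s with hS
  set A' : ℂ[X] := (S.map fun z => X - C z).prod with hA'
  have hconj : Q.roots.map (starRingEnd ℂ) = Q.roots := by
    rw [← (IsAlgClosed.splits Q).roots_map (starRingEnd ℂ), hQ, Polynomial.map_map]
    congr 2
    ext x
    simp
  have hSconj : S.map (starRingEnd ℂ) = S := by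
    conv_rhs => rw [hS, ← hconj]
    rw [Multiset.filter_map, hS]
    simp
  have hA'conj : A'.map (starRingEnd ℂ) = A' := by
    rw [hA', Polynomial.map_multiset_prod, Multiset.map_map]
    conv_rhs => rw [← hSconj, Multiset.map_map]
    simp
  have hlift : A' ∈ lifts Complex.ofRealHom := by
    rw [lifts_iff_coeff_lifts]
    intro n
    have := congrArg (fun p => p.coeff n) hA'conj
    simp only [coeff_map] at this
    exact ⟨_, Complex.conj_eq_iff_re.1 this⟩
  have hmonic' : A'.Monic := monic_multiset_prod_of_monic _ _ fun z _ => monic_X_sub_C z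
  obtain ⟨A, hA, -, hmonic⟩ := lifts_and_natDegree_eq_and_monic hlift hmonic'
  have hdvd' : A' ∣ Q := by
    rw [hA']
    refine (Multiset.prod_dvd_prod_of_le (Multiset.map_le_map (Multiset.filter_le _ _))).trans ?_
    exact prod_multiset_X_sub_C_dvd Q
  have hdvd : A ∣ P := by
    rw [← Polynomial.map_dvd_map' Complex.ofRealHom, hA]
    exact hdvd'
  obtain ⟨B, hB⟩ := hdvd
  refine ⟨A, B, by rw [hB, mul_comm], hmonic, hA, ?_⟩
  have hr : Q.roots = S + (B.map Complex.ofRealHom).roots := by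
    have h1 : Q = A' * B.map Complex.ofRealHom := by rw [hQ, hB, Polynomial.map_mul, hA]
    rw [h1, roots_mul (h1 ▸ hQ0), hA', roots_multiset_prod_X_sub_C]
  have hr2 : (B.map Complex.ofRealHom).roots = Q.roots.filter fun z => ¬ ‖z‖ < s := by
    have h1 := Multiset.filter_add_not (fun z : ℂ => ‖z‖ < s) Q.roots
    rw [← hS] at h1
    exact (add_left_cancel (h1.trans hr)).symm
  intro z hz
  rw [hr2, Multiset.mem_filter, not_lt] at hz
  exact hz.2

end

/-! ### Decaying solutions with boundary conditions -/

section

open Polynomial Filter Topology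

/-- Square-summable real sequences: the amplitudes of a mode, numbered from the boundary. -/
abbrev Amplitudes : Type := lp (fun _ : ℕ => ℝ) 2

/-- The sequence `x`, preceded by `N` zeros. -/
def pad (N : ℕ) (x : ℕ → ℝ) (k : ℕ) : ℝ := if k < N then 0 else x (k - N)

theorem pad_add (N : ℕ) (x : ℕ → ℝ) (n : ℕ) : pad N x (n + N) = x n := by
  simp [pad]

/-- The amplitudes that solve the recurrence `P`, with `N` boundary conditions, and are
`o(s ^ n)`. -/
def edgeSpace (P : ℝ[X]) (N : ℕ) (s : ℝ) : Submodule ℝ Amplitudes where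
  carrier := {x | recurrence P (pad N x) = 0 ∧ Tendsto (fun n => x n / s ^ n) atTop (𝓝 0)}
  zero_mem' := by
    have h : pad N (⇑(0 : Amplitudes)) = 0 := by ext k; simp [pad]
    exact ⟨by rw [h, map_zero], by simp⟩
  add_mem' := by
    rintro x y ⟨hx, hx'⟩ ⟨hy, hy'⟩
    have h : pad N (⇑(x + y)) = pad N x + pad N y := by
      ext k; simp only [pad, lp.coeFn_add, Pi.add_apply]; split_ifs <;> simp
    refine ⟨by rw [h, map_add, hx, hy, add_zero], ?_⟩
    simpa [add_div] using hx'.add hy'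
  smul_mem' := by
    rintro a x ⟨hx, hx'⟩
    have h : pad N (⇑(a • x)) = a • pad N x := by
      ext k; simp only [pad, lp.coeFn_smul, Pi.smul_apply]; split_ifs <;> simp
    refine ⟨by rw [h, map_smul, hx, smul_zero], ?_⟩
    simpa [mul_div_assoc] using hx'.const_mul a

theorem mem_edgeSpace {P : ℝ[X]} {N : ℕ} {s : ℝ} {x : Amplitudes} :
    x ∈ edgeSpace P N s ↔
      recurrence P (pad N x) = 0 ∧ Tendsto (fun n => x n / s ^ n) atTop (𝓝 0) := Iff.rfl

theorem tendsto_div_pow_of_le {x : ℕ → ℝ} {r s K : ℝ} (hr : 0 ≤ r) (hrs : r < s)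
    (h : ∀ n, |x n| ≤ K * r ^ n) : Tendsto (fun n => x n / s ^ n) atTop (𝓝 0) := by
  have hs : 0 < s := hr.trans_lt hrs
  have h1 : Tendsto (fun n => K * (r / s) ^ n) atTop (𝓝 0) := by
    simpa using (tendsto_pow_atTop_nhds_zero_of_lt_one (div_nonneg hr hs.le)
      ((div_lt_one hs).2 hrs)).const_mul K
  refine squeeze_zero_norm (fun n => ?_) h1
  rw [norm_div, norm_pow, Real.norm_eq_abs, Real.norm_of_nonneg hs.le, div_pow, ← mul_div_assoc]
  gcongr
  exact h n

theorem bounded_of_tendsto_div_pow {x : ℕ → ℝ} {s : ℝ} (hs : 0 < s)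
    (h : Tendsto (fun n => x n / s ^ n) atTop (𝓝 0)) : ∃ K, ∀ n, |x n| ≤ K * s ^ n := by
  obtain ⟨K, hK⟩ := h.norm.bddAbove_range
  refine ⟨K, fun n => ?_⟩
  have h1 : ‖x n / s ^ n‖ ≤ K := hK ⟨n, rfl⟩
  rwa [norm_div, norm_pow, Real.norm_eq_abs, Real.norm_of_nonneg hs.le,
    div_le_iff₀ (pow_pos hs n)] at h1

theorem edgeSpace_mono (P : ℝ[X]) (N : ℕ) {r s : ℝ} (hr : 0 < r) (hrs : r ≤ s) :
    edgeSpace P N r ≤ edgeSpace P N s := by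
  rcases hrs.eq_or_lt with rfl | hrs
  · exact le_rfl
  · rintro x ⟨h1, h2⟩
    obtain ⟨K, hK⟩ := bounded_of_tendsto_div_pow hr h2
    exact ⟨h1, tendsto_div_pow_of_le hr.le hrs hK⟩

/-- The zero count `#{z | P z = 0, |z| < s}`, with multiplicity. -/
def rootsBelow (P : ℝ[X]) (s : ℝ) : ℕ :=
  ((P.map Complex.ofRealHom).roots.filter fun z => ‖z‖ < s).card

theorem exists_between_of_forall_norm_lt {S : Multiset ℂ} {s : ℝ} (hs : 0 < s)
    (hS : ∀ z ∈ S, ‖z‖ < s) : ∃ r, 0 < r ∧ r < s ∧ ∀ z ∈ S, ‖z‖ < r := by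
  induction S using Multiset.induction with
  | empty => exact ⟨s / 2, by positivity, by linarith, by simp⟩
  | cons z S ih =>
    obtain ⟨r, hr, hrs, h⟩ := ih fun w hw => hS w (Multiset.mem_cons_of_mem hw)
    obtain ⟨q, hq, hqs⟩ := exists_between (hS z (Multiset.mem_cons_self z S))
    refine ⟨max r q, lt_max_of_lt_left hr, max_lt hrs hqs, fun w hw => ?_⟩
    rcases Multiset.mem_cons.1 hw with rfl | hw
    · exact lt_max_of_lt_right hq
    · exact lt_max_of_lt_left (h w hw)

/-- Decaying like `o(s ^ n)` means to solve the recurrence given by the roots of modulus less than `s`;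
such a solution decays like `O(r ^ n)` for some `r < s`. -/
theorem exists_factor_edgeSpace (P : ℝ[X]) (hP : P ≠ 0) {s : ℝ} (hs : 0 < s) :
    ∃ A : ℝ[X], A.Monic ∧ A.natDegree = rootsBelow P s ∧
      (∃ r, 0 < r ∧ r < s ∧ ∀ β : ℕ → ℝ, recurrence A β = 0 → ∃ K, ∀ n, |β n| ≤ K * r ^ n) ∧
      ∀ (N : ℕ) (x : Amplitudes), x ∈ edgeSpace P N s ↔ recurrence A (pad N x) = 0 := by
  obtain ⟨A, B, hPAB, hA, hroots, hB⟩ := exists_factor_roots_lt P hP s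
  set S := (P.map Complex.ofRealHom).roots.filter fun z => ‖z‖ < s with hS
  obtain ⟨r, hr, hrs, hSr⟩ := exists_between_of_forall_norm_lt (S := S) hs
    fun z hz => (Multiset.mem_filter.1 hz).2
  have hcast : ∀ (C : ℝ[X]) (β : ℕ → ℝ),
      recurrence (C.map Complex.ofRealHom) (fun n => (β n : ℂ)) =
        fun n => ((recurrence C β n : ℝ) : ℂ) := fun C β => funext (recurrence_ofReal C β)
  have hdecay : ∀ β : ℕ → ℝ, recurrence A β = 0 → ∃ K, ∀ n, |β n| ≤ K * r ^ n := by
    intro β hβ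
    have h1 := hcast A β
    rw [hβ, hroots] at h1
    obtain ⟨K, hK⟩ := exists_bound_of_recurrence_eq_zero hSr (h1.trans (by ext; simp))
    exact ⟨K, fun n => by simpa using hK n⟩
  refine ⟨A, hA, ?_, ⟨r, hr, hrs, hdecay⟩, fun N x => ⟨?_, fun h => ⟨?_, ?_⟩⟩⟩
  · rw [← natDegree_map Complex.ofRealHom, hroots, natDegree_multiset_prod_X_sub_C_eq_card]; rfl
  · rintro ⟨h1, h2⟩
    have hpad : Tendsto (fun n => pad N x n / s ^ n) atTop (𝓝 0) := by
      rw [← tendsto_add_atTop_iff_nat N]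
      have h3 := h2.mul_const (s ^ N)⁻¹
      rw [zero_mul] at h3
      refine h3.congr fun n => ?_
      rw [pad_add, pow_add]
      field_simp
    -- `g` solves the recurrence given by the roots of modulus at least `s`, and is still `o(s ^ n)`.
    set g := recurrence A (pad N x) with hg
    have hg0 : Tendsto (fun n => g n / s ^ n) atTop (𝓝 0) := by
      have h3 : Tendsto (fun n => ∑ k ∈ Finset.range (A.natDegree + 1),
          (A.coeff k * s ^ k) * (pad N x (n + k) / s ^ (n + k))) atTop (𝓝 0) := by
        rw [← Finset.sum_const_zero (s := Finset.range (A.natDegree + 1))]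
        refine tendsto_finsetSum _ fun k _ => ?_
        simpa using ((tendsto_add_atTop_iff_nat k).2 hpad).const_mul (A.coeff k * s ^ k)
      refine h3.congr fun n => ?_
      rw [hg, recurrence_apply, Finset.sum_div]
      refine Finset.sum_congr rfl fun k _ => ?_
      rw [pow_add]
      field_simp
    have hBg : recurrence B g = 0 := by rw [hg, ← recurrence_mul, ← hPAB, h1]
    have hB0 : B ≠ 0 := by rintro rfl; exact hP (by rw [hPAB, zero_mul])
    have hB0' : B.map Complex.ofRealHom ≠ 0 :=
      (Polynomial.map_ne_zero_iff Complex.ofRealHom.injective).2 hB0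
    have hBg' := hcast B g
    rw [hBg, (IsAlgClosed.splits (B.map Complex.ofRealHom)).eq_prod_roots, recurrence_mul,
      recurrence_C_apply] at hBg'
    have h4 := (smul_eq_zero.1 (hBg'.trans (by ext; simp))).resolve_left
      (leadingCoeff_ne_zero.2 hB0')
    have h5 := eq_zero_of_isLittleO_of_recurrence hs hB ?_ h4
    · ext n
      simpa using congrFun h5 n
    · rw [← Complex.ofReal_zero]
      refine ((Complex.continuous_ofReal.tendsto 0).comp hg0).congr fun n => ?_
      simp
  · rw [hPAB, recurrence_mul, h, map_zero]
  · obtain ⟨K, hK⟩ := hdecay _ h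
    refine tendsto_div_pow_of_le (K := K * r ^ N) hr.le hrs fun n => ?_
    have := hK (n + N)
    rw [pad_add] at this
    rw [mul_assoc, ← pow_add, add_comm N n]
    exact this

theorem memℓp_of_le_geometric {x : ℕ → ℝ} {r K : ℝ} (hr : 0 ≤ r) (hr1 : r < 1)
    (h : ∀ n, |x n| ≤ K * r ^ n) : Memℓp x 2 := by
  have hK : 0 ≤ K := by simpa using (abs_nonneg _).trans (h 0)
  refine memℓp_gen ?_
  have h1 : Summable fun n : ℕ => K ^ 2 * (r ^ 2) ^ n :=
    (summable_geometric_of_lt_one (by positivity) (by nlinarith)).mul_left _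
  refine h1.of_nonneg_of_le (fun n => by positivity) fun n => ?_
  simp only [ENNReal.toReal_ofNat, Real.rpow_ofNat, Real.norm_eq_abs]
  calc |x n| ^ 2 ≤ (K * r ^ n) ^ 2 := by gcongr; exact h n
    _ = _ := by ring

/-- Each boundary condition removes one dimension from the space of decaying solutions. -/
theorem nonempty_edgeSpace_equiv (P : ℝ[X]) (hP : P ≠ 0) (N : ℕ) {s : ℝ} (hs : 0 < s)
    (hs1 : s ≤ 1) :
    Nonempty (edgeSpace P N s ≃ₗ[ℝ] (Fin (rootsBelow P s - N) → ℝ)) := by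
  obtain ⟨A, hA, hdeg, ⟨r, hr, hrs, hdecay⟩, hmem⟩ := exists_factor_edgeSpace P hP hs
  let φ : edgeSpace P N s →ₗ[ℝ] (Fin (rootsBelow P s - N) → ℝ) :=
    { toFun := fun x k => (x : Amplitudes) k
      map_add' := fun x y => by ext; simp
      map_smul' := fun a x => by ext; simp }
  refine ⟨LinearEquiv.ofBijective φ ⟨?_, ?_⟩⟩
  · rw [← LinearMap.ker_eq_bot, LinearMap.ker_eq_bot']
    intro x hx
    have h1 : pad N (x : Amplitudes) = 0 := by
      refine eq_zero_of_monic_recurrence hA ((hmem N x).1 x.2) fun k hk => ?_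
      unfold pad
      split_ifs with hkN
      · rfl
      · exact congrFun hx ⟨k - N, by omega⟩
    ext n
    have h2 := congrFun h1 (n + N)
    rw [pad_add] at h2
    exact h2
  · intro w
    rcases le_or_gt (rootsBelow P s) N with hN | hN
    · exact ⟨0, funext fun k => absurd k.2 (by omega)⟩
    · obtain ⟨β, hβ, hβw⟩ := exists_monic_recurrence hA
        fun k => if h : (k : ℕ) < N then 0 else w ⟨k - N, by omega⟩
      obtain ⟨K, hK⟩ := hdecay β hβ
      have hx : Memℓp (fun n => β (n + N)) 2 := by
        refine memℓp_of_le_geometric (K := K * r ^ N) hr.le (hrs.trans_le hs1) fun n => ?_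
        rw [mul_assoc, ← pow_add, add_comm N n]
        exact hK _
      let x : Amplitudes := ⟨fun n => β (n + N), hx⟩
      have hpad : pad N x = β := by
        ext k
        unfold pad
        split_ifs with hk
        · have := hβw ⟨k, by omega⟩
          simpa [hk] using this.symm
        · change β (k - N + N) = β k
          rw [Nat.sub_add_cancel (not_lt.1 hk)]
      refine ⟨⟨x, (hmem N x).2 (by rw [hpad, hβ])⟩, funext fun k => ?_⟩
      have := hβw ⟨k + N, by omega⟩
      change β (k + N) = w k
      simpa using this

theorem finrank_edgeSpace (P : ℝ[X]) (hP : P ≠ 0) (N : ℕ) {s : ℝ} (hs : 0 < s) (hs1 : s ≤ 1) :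
    Module.finrank ℝ (edgeSpace P N s) = rootsBelow P s - N := by
  obtain ⟨e⟩ := nonempty_edgeSpace_equiv P hP N hs hs1
  rw [e.finrank_eq, Module.finrank_fin_fun]

theorem finiteDimensional_edgeSpace (P : ℝ[X]) (hP : P ≠ 0) (N : ℕ) {s : ℝ} (hs : 0 < s)
    (hs1 : s ≤ 1) : FiniteDimensional ℝ (edgeSpace P N s) := by
  obtain ⟨e⟩ := nonempty_edgeSpace_equiv P hP N hs hs1
  exact e.symm.finiteDimensional

/-- A chain of subspaces of a finite-dimensional space has an adapted orthonormal basis: the members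
of the chain are the spans of its initial segments. -/
theorem exists_orthonormal_adapted {E : Type*} [NormedAddCommGroup E] [InnerProductSpace ℝ E] (k : ℕ)
    (W : Submodule ℝ E) [FiniteDimensional ℝ W] (hW : Module.finrank ℝ W = k)
    (𝒞 : Set (Submodule ℝ E)) (h𝒞 : IsChain (· ≤ ·) 𝒞) (hle : ∀ U ∈ 𝒞, U ≤ W) :
    ∃ v : Fin k → E, Orthonormal ℝ v ∧ Submodule.span ℝ (Set.range v) = W ∧
      ∀ U ∈ 𝒞, ∀ i : Fin k, v i ∈ U ↔ (i : ℕ) < Module.finrank ℝ U := by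
  classical
  induction k generalizing W 𝒞 with
  | zero =>
    have hW0 : W = ⊥ := Submodule.finrank_eq_zero.1 hW
    exact ⟨Fin.elim0, ⟨fun i => i.elim0, fun i => i.elim0⟩, by simp [hW0], fun _ _ i => i.elim0⟩
  | succ k ih =>
    -- `U₀` is the largest proper member of the chain; the last basis vector is orthogonal to it.
    obtain ⟨U₀, hU₀W, hU₀ne, hU₀⟩ : ∃ U₀ ≤ W, U₀ ≠ W ∧ ∀ U ∈ 𝒞, U ≠ W → U ≤ U₀ := by
      by_cases h : ∃ U ∈ 𝒞, U ≠ W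
      · have hb : BddAbove ((fun U : Submodule ℝ E => Module.finrank ℝ U) '' {U ∈ 𝒞 | U ≠ W}) := by
          refine ⟨Module.finrank ℝ W, ?_⟩
          rintro _ ⟨U, hU, rfl⟩
          exact Submodule.finrank_mono (hle U hU.1)
        obtain ⟨U₁, hU₁, hU₁W⟩ := h
        have hne : ((fun U : Submodule ℝ E => Module.finrank ℝ U) '' {U ∈ 𝒞 | U ≠ W}).Nonempty :=
          ⟨_, U₁, ⟨hU₁, hU₁W⟩, rfl⟩
        obtain ⟨U₀, hU₀, hmax⟩ := Nat.sSup_mem hne hb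
        refine ⟨U₀, hle _ hU₀.1, hU₀.2, fun U hU hUW => ?_⟩
        rcases h𝒞.total hU hU₀.1 with h1 | h1
        · exact h1
        · have : FiniteDimensional ℝ U := Submodule.finiteDimensional_of_le (hle U hU)
          refine (Submodule.eq_of_le_of_finrank_le h1 ?_).ge
          exact (le_csSup hb ⟨U, ⟨hU, hUW⟩, rfl⟩).trans_eq hmax.symm
      · push Not at h
        refine ⟨⊥, bot_le, ?_, fun U hU hUW => absurd (h U hU) hUW⟩
        rintro rfl
        simp at hW
    have : FiniteDimensional ℝ U₀ := Submodule.finiteDimensional_of_le hU₀W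
    obtain ⟨e₀, he₀, he₀0⟩ : ∃ e ∈ U₀ᗮ ⊓ W, e ≠ 0 := by
      refine Submodule.exists_mem_ne_zero_of_ne_bot fun h => ?_
      have := Submodule.sup_orthogonal_inf_of_hasOrthogonalProjection hU₀W
      rw [h, sup_bot_eq] at this
      exact hU₀ne this
    set e : E := (‖e₀‖⁻¹ : ℝ) • e₀ with he
    have heU₀ : e ∈ U₀ᗮ := Submodule.smul_mem _ _ he₀.1
    have heW : e ∈ W := Submodule.smul_mem _ _ he₀.2
    have he1 : ‖e‖ = 1 := by rw [he, norm_smul]; simp [he₀0]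
    have hspan : Submodule.span ℝ {e} ≤ W := by simpa using heW
    set W' := (Submodule.span ℝ {e})ᗮ ⊓ W with hW'
    have hW'fin : FiniteDimensional ℝ W' := Submodule.finiteDimensional_of_le inf_le_right
    have hW'rank : Module.finrank ℝ W' = k := by
      have h1 := Submodule.finrank_add_inf_finrank_orthogonal hspan
      rw [finrank_span_singleton (by rw [← norm_ne_zero_iff, he1]; exact one_ne_zero), hW] at h1
      change 1 + Module.finrank ℝ W' = k + 1 at h1
      omega
    have hUW' : ∀ U ∈ 𝒞, U ≠ W → U ≤ W' := fun U hU hUW x hx =>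
      ⟨Submodule.mem_orthogonal_singleton_iff_inner_right.2
        (Submodule.inner_left_of_mem_orthogonal (hU₀ U hU hUW hx) heU₀), hle U hU hx⟩
    obtain ⟨v, hv, hvspan, hvU⟩ := ih W' hW'rank {U ∈ 𝒞 | U ≠ W}
      (h𝒞.mono fun U hU => hU.1) fun U hU => hUW' U hU.1 hU.2
    have hvW' : ∀ i, v i ∈ W' := fun i => hvspan ▸ Submodule.subset_span ⟨i, rfl⟩
    have hev : ∀ i, inner ℝ e (v i) = 0 := fun i =>
      Submodule.mem_orthogonal_singleton_iff_inner_right.1 (hvW' i).1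
    refine ⟨Fin.snoc v e, ⟨?_, ?_⟩, ?_, ?_⟩
    · intro i
      induction i using Fin.lastCases with
      | last => simpa using he1
      | cast i => simpa using hv.1 i
    · intro i j hij
      induction i using Fin.lastCases with
      | last =>
        induction j using Fin.lastCases with
        | last => exact absurd rfl hij
        | cast j => simpa using hev j
      | cast i =>
        induction j using Fin.lastCases with
        | last => simpa [real_inner_comm] using hev i
        | cast j => simpa using hv.2 fun h => hij (by rw [h])
    · rw [Fin.range_snoc, Submodule.span_insert, hvspan, hW']
      exact Submodule.sup_orthogonal_inf_of_hasOrthogonalProjection hspan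
    · intro U hU i
      by_cases hUW : U = W
      · subst hUW
        rw [hW]
        refine iff_of_true ?_ i.2
        induction i using Fin.lastCases with
        | last => simpa using heW
        | cast i => simpa using (hvW' i).2
      · induction i using Fin.lastCases with
        | last =>
          refine iff_of_false (fun h => ?_) ?_
          · have h1 := (hUW' U hU hUW (by simpa using h)).1
            have h2 := Submodule.mem_orthogonal_singleton_iff_inner_right.1 h1
            rw [real_inner_self_eq_norm_sq, he1] at h2
            norm_num at h2
          · have := Submodule.finrank_mono (hUW' U hU hUW)
            simp only [Fin.val_last]
            omega
        | cast i => simpa using hvU U ⟨hU, hUW⟩ i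

end

/-! ### The kernel of a semi-infinite Toeplitz operator -/

section

open Polynomial Filter Topology

/-- The numerator `z ^ N_p * f(z)` as a real polynomial. -/
def realNumerator (t : ℤ →₀ ℝ) : ℝ[X] :=
  t.sum fun α a => monomial (α + poleOrder t).toNat a

theorem map_realNumerator (t : ℤ →₀ ℝ) :
    (realNumerator t).map Complex.ofRealHom = numerator t := by
  simp [realNumerator, numerator, Finsupp.sum, Polynomial.map_sum]

theorem neg_poleOrder_le {t : ℤ →₀ ℝ} {α : ℤ} (hα : α ∈ t.support) : -(poleOrder t : ℤ) ≤ α := by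
  have h1 : (-α).toNat ≤ poleOrder t := Finset.le_sup (f := fun α : ℤ => (-α).toNat) hα
  omega

theorem coeff_numerator (t : ℤ →₀ ℝ) (k : ℕ) :
    (numerator t).coeff k = (t (k - poleOrder t) : ℂ) := by
  rw [numerator, Finsupp.sum, finsetSum_coeff]
  have h : ∀ α ∈ t.support, (monomial (α + poleOrder t).toNat (t α : ℂ)).coeff k =
      if (k - poleOrder t : ℤ) = α then (t α : ℂ) else 0 := by
    intro α hα
    have := neg_poleOrder_le hα
    rw [coeff_monomial]
    refine if_congr ?_ rfl rfl
    omega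
  rw [Finset.sum_congr rfl h, Finset.sum_ite_eq]
  split_ifs with h1
  · rfl
  · rw [Finsupp.notMem_support_iff.1 h1, Complex.ofReal_zero]

theorem numerator_ne_zero {t : ℤ →₀ ℝ} (ht : t ≠ 0) : numerator t ≠ 0 := by
  obtain ⟨α, hα⟩ := Finsupp.support_nonempty_iff.2 ht
  intro h
  have h1 := neg_poleOrder_le hα
  have h2 := coeff_numerator t (α + poleOrder t).toNat
  rw [h, Int.toNat_of_nonneg (by omega)] at h2
  simp at h2
  exact Finsupp.mem_support_iff.1 hα (by exact_mod_cast h2.symm)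

theorem realNumerator_ne_zero {t : ℤ →₀ ℝ} (ht : t ≠ 0) : realNumerator t ≠ 0 := by
  rw [← Polynomial.map_ne_zero_iff Complex.ofRealHom.injective, map_realNumerator]
  exact numerator_ne_zero ht

/-- The semi-infinite Toeplitz operator of `t` annihilates `x`. -/
def InToeplitzKernel (t : ℤ →₀ ℝ) (x : ℕ → ℝ) : Prop :=
  ∀ n : ℕ, HasSum (fun m : ℕ => t ((m : ℤ) - n) * x m) 0

/-- The amplitudes on the missing sites beyond the boundary count as zero: these are the boundary
conditions, one for each order of the pole. -/
theorem inToeplitzKernel_iff (t : ℤ →₀ ℝ) (x : ℕ → ℝ) :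
    InToeplitzKernel t x ↔ recurrence (realNumerator t) (pad (poleOrder t) x) = 0 := by
  have key : ∀ n : ℕ, HasSum (fun m : ℕ => t ((m : ℤ) - n) * x m)
      (recurrence (realNumerator t) (pad (poleOrder t) x) n) := by
    intro n
    have h1 : recurrence (realNumerator t) (pad (poleOrder t) x) n =
        ∑ α ∈ t.support, t α * pad (poleOrder t) x (n + (α + poleOrder t).toNat) := by
      rw [realNumerator, Finsupp.sum, recurrence, map_sum, LinearMap.sum_apply, Finset.sum_apply]
      exact Finset.sum_congr rfl fun α _ => recurrence_monomial_apply _ _ _ n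
    have h2 : ∀ α ∈ t.support, HasSum (fun m : ℕ => if (m : ℤ) - n = α then t α * x m else 0)
        (t α * pad (poleOrder t) x (n + (α + poleOrder t).toNat)) := by
      intro α hα
      have h3 := neg_poleOrder_le hα
      unfold pad
      split_ifs with h4
      · rw [mul_zero]
        convert hasSum_zero using 2 with m
        exact if_neg (by omega)
      · have h5 := hasSum_single (f := fun m : ℕ => if (m : ℤ) - n = α then t α * x m else 0)
          (n + (α + poleOrder t).toNat - poleOrder t) fun m hm => if_neg (by omega)
        rwa [if_pos (by omega)] at h5
    rw [h1]
    convert hasSum_sum h2 using 2 with m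
    rw [Finset.sum_ite_eq]
    split_ifs with h3
    · rfl
    · rw [Finsupp.notMem_support_iff.1 h3, zero_mul]
  constructor
  · intro h
    funext n
    exact (key n).unique (h n)
  · intro h n
    have := key n
    rwa [h] at this

theorem summable_sq_amplitudes (x : Amplitudes) : Summable fun n => x n ^ 2 := by
  have := (memℓp_gen_iff (p := 2) (by norm_num)).1 (lp.memℓp x)
  simpa using this

theorem mem_edgeSpace_one_iff (t : ℤ →₀ ℝ) (x : Amplitudes) :
    x ∈ edgeSpace (realNumerator t) (poleOrder t) 1 ↔ InToeplitzKernel t x := by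
  rw [mem_edgeSpace, inToeplitzKernel_iff]
  refine and_iff_left ?_
  have h2 := (summable_sq_amplitudes x).tendsto_atTop_zero.sqrt
  rw [Real.sqrt_zero] at h2
  simp only [one_pow, div_one]
  rw [tendsto_zero_iff_norm_tendsto_zero]
  refine h2.congr fun n => ?_
  rw [Real.sqrt_sq_eq_abs, Real.norm_eq_abs]

theorem exists_sorted_list {X : Type*} (m : X → ℝ) (s : Multiset X) :
    ∃ l : List X, (l : Multiset X) = s ∧ l.Pairwise fun x y => m x ≤ m y := by
  classical
  have : Std.Total fun x y : X => m x ≤ m y := ⟨fun x y => le_total _ _⟩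
  have : IsTrans X fun x y => m x ≤ m y := ⟨fun x y z => le_trans⟩
  refine ⟨s.toList.insertionSort fun x y => m x ≤ m y, ?_, List.pairwise_insertionSort _ _⟩
  rw [Multiset.coe_eq_coe.2 (List.perm_insertionSort _ _), Multiset.coe_toList]

/-- The `k` largest elements exist, listed in increasing order: all but the first `N` of a sorted list. The
number of elements below a level then tells which of them lie below it. -/
theorem exists_isLargest {X : Type*} (m : X → ℝ) (s : Multiset X) (N k : ℕ)
    (hk : k = s.card - N) : ∃ z : Fin k → X, IsLargest m s z ∧
      ∀ (i : Fin k) (r : ℝ), (r ≤ m (z i) → (s.filter fun x => m x < r).card ≤ N + i) ∧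
        (m (z i) < r → N + i < (s.filter fun x => m x < r).card) := by
  classical
  obtain ⟨l, hl, hsort⟩ := exists_sorted_list m s
  have hlen : l.length = s.card := by rw [← hl, Multiset.coe_card]
  have hget : ∀ i j (hi : i < l.length) (hj : j < l.length), i ≤ j → m l[i] ≤ m l[j] := by
    intro i j hi hj hij
    rcases hij.eq_or_lt with rfl | hij
    · exact le_rfl
    · exact List.pairwise_iff_getElem.1 hsort i j hi hj hij
  refine ⟨fun i => l[N + i]'(by omega), ⟨(l.take N : List X), ?_, ?_⟩, ?_⟩
  · have h1 : (Finset.univ.val.map fun i : Fin k => l[N + i]'(by omega)) = (l.drop N : List X) := by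
      rw [Fin.univ_val_map]
      congr 1
      refine List.ext_getElem (by simp; omega) fun i h1 h2 => ?_
      simp
    rw [h1, Multiset.coe_add, ← hl]
    refine Multiset.coe_eq_coe.2 ?_
    exact (List.perm_append_comm.trans (List.Perm.of_eq (List.take_append_drop N l))).symm
  · intro i w hw
    obtain ⟨j, hj, rfl⟩ := List.mem_iff_getElem.1 (Multiset.mem_coe.1 hw)
    rw [List.getElem_take]
    simp only [List.length_take] at hj
    exact hget _ _ _ _ (by omega)
  · intro i r
    have hi : N + i < l.length := by omega
    have hcard : (s.filter fun x => m x < r).card = (l.filter fun x => m x < r).length := by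
      rw [← hl, Multiset.filter_coe, Multiset.coe_card]
    rw [hcard]
    constructor
    · intro hr
      have h0 : (l.drop (N + i)).filter (fun x => m x < r) = [] := by
        rw [List.filter_eq_nil_iff]
        intro x hx
        obtain ⟨j, hj, rfl⟩ := List.mem_iff_getElem.1 hx
        rw [List.getElem_drop]
        simp only [decide_eq_true_eq, not_lt]
        exact hr.trans (hget _ _ _ _ (by omega))
      rw [← List.take_append_drop (N + i) l, List.filter_append, h0, List.append_nil]
      exact (List.length_filter_le _ _).trans (by simp)
    · intro hr
      have h0 : (l.take (N + i + 1)).filter (fun x => m x < r) = l.take (N + i + 1) := by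
        rw [List.filter_eq_self]
        intro x hx
        obtain ⟨j, hj, rfl⟩ := List.mem_iff_getElem.1 hx
        rw [List.getElem_take]
        simp only [List.length_take] at hj
        simp only [decide_eq_true_eq]
        exact (hget _ _ _ _ (by omega)).trans_lt hr
      rw [← List.take_append_drop (N + i + 1) l, List.filter_append, h0, List.length_append,
        List.length_take]
      omega

theorem rootsBelow_realNumerator (t : ℤ →₀ ℝ) {s : ℝ} (hs : s ≤ 1) :
    rootsBelow (realNumerator t) s = ((zerosInside t).filter fun z => ‖z‖ < s).card := by
  rw [rootsBelow, map_realNumerator, zerosInside, Multiset.filter_filter]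
  congr 1
  refine Multiset.filter_congr fun z _ => ?_
  exact ⟨fun h => ⟨h, h.trans_le hs⟩, fun h => h.1⟩

/-- The kernel of the semi-infinite Toeplitz operator has dimension `max ω 0`, and an orthonormal basis
that decays at the rates given by the largest zeros inside the disk. -/
theorem exists_toeplitzKernel_basis {t : ℤ →₀ ℝ} (ht : t ≠ 0) {k : ℕ}
    (hk : k = (omega t).toNat) :
    ∃ z : Fin k → ℂ, IsLargest (fun w : ℂ => ‖w‖) (zerosInside t) z ∧
      ∃ v : Fin k → Amplitudes, Orthonormal ℝ v ∧
        (∀ x : Amplitudes, InToeplitzKernel t x ↔ x ∈ Submodule.span ℝ (Set.range v)) ∧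
        ∀ i, ‖z i‖ < 1 ∧
          (∀ s, ‖z i‖ < s → s < 1 → ∃ K, ∀ n, |v i n| ≤ K * s ^ n) ∧
          ∀ s, 0 < s → s < ‖z i‖ → ¬ ∃ K, ∀ n, |v i n| ≤ K * s ^ n := by
  set P := realNumerator t with hP
  have hP0 : P ≠ 0 := realNumerator_ne_zero ht
  set N := poleOrder t with hN
  have hk' : k = (zerosInside t).card - N := by rw [hk, omega]; omega
  obtain ⟨z, hz, hcount⟩ := exists_isLargest (fun w : ℂ => ‖w‖) (zerosInside t) N k hk'
  have hz1 : ∀ i, ‖z i‖ < 1 := by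
    obtain ⟨rest, hrest, -⟩ := hz
    intro i
    have : z i ∈ zerosInside t := by
      rw [hrest, Multiset.mem_add]
      exact Or.inl (Multiset.mem_map_of_mem z (Finset.mem_univ_val i))
    exact (Multiset.mem_filter.1 this).2
  have hfin := finiteDimensional_edgeSpace P hP0 N one_pos le_rfl
  have hrank : ∀ s, 0 < s → s ≤ 1 → Module.finrank ℝ (edgeSpace P N s) =
      ((zerosInside t).filter fun z => ‖z‖ < s).card - N := fun s hs hs1 => by
    rw [finrank_edgeSpace P hP0 N hs hs1, hP, rootsBelow_realNumerator t hs1]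
  have hrank1 : Module.finrank ℝ (edgeSpace P N 1) = k := by
    rw [hrank 1 one_pos le_rfl, hk', Multiset.filter_eq_self.2]
    exact fun z hz => (Multiset.mem_filter.1 hz).2
  obtain ⟨v, hv, hspan, hvU⟩ := exists_orthonormal_adapted k (edgeSpace P N 1) hrank1
    (edgeSpace P N '' Set.Ioc 0 1)
    (by
      rintro _ ⟨r, hr, rfl⟩ _ ⟨s, hs, rfl⟩ -
      rcases le_total r s with h | h
      · exact Or.inl (edgeSpace_mono P N hr.1 h)
      · exact Or.inr (edgeSpace_mono P N hs.1 h))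
    (by
      rintro _ ⟨s, hs, rfl⟩
      exact edgeSpace_mono P N hs.1 hs.2)
  have hvU' : ∀ s, 0 < s → s ≤ 1 → ∀ i, v i ∈ edgeSpace P N s ↔
      (i : ℕ) < ((zerosInside t).filter fun z => ‖z‖ < s).card - N := fun s hs hs1 i => by
    rw [hvU _ ⟨s, ⟨hs, hs1⟩, rfl⟩, hrank s hs hs1]
  refine ⟨z, hz, v, hv, fun x => ?_, fun i => ⟨hz1 i, fun s hs hs1 => ?_, fun s hs hsz => ?_⟩⟩
  · rw [hspan, hP, hN, mem_edgeSpace_one_iff]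
  · have hs0 : 0 < s := (norm_nonneg _).trans_lt hs
    have h1 := (hcount i s).2 hs
    exact bounded_of_tendsto_div_pow hs0 ((hvU' s hs0 hs1.le i).2 (by omega)).2
  · rintro ⟨K, hK⟩
    -- A faster decay would put `v i` into a member of the flag of dimension at most `i`.
    have h1 : v i ∈ edgeSpace P N ‖z i‖ :=
      ⟨(hspan ▸ Submodule.subset_span ⟨i, rfl⟩ : v i ∈ edgeSpace P N 1).1,
        tendsto_div_pow_of_le hs.le hsz hK⟩
    rw [hvU' _ (hs.trans hsz) (hz1 i).le] at h1
    have h2 := (hcount i ‖z i‖).1 le_rfl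
    omega

end

/-! ### Reflection of the chain -/

section

open Polynomial

/-- The couplings of the mirror image of the chain; its symbol is `f(1 / z)`. -/
def reflect (t : ℤ →₀ ℝ) : ℤ →₀ ℝ := t.equivMapDomain (Equiv.neg ℤ)

@[simp] theorem reflect_apply (t : ℤ →₀ ℝ) (α : ℤ) : reflect t α = t (-α) := rfl

theorem reflect_ne_zero {t : ℤ →₀ ℝ} (ht : t ≠ 0) : reflect t ≠ 0 := by
  intro h
  refine ht (Finsupp.ext fun α => ?_)
  have := DFunLike.congr_fun h (-α)
  simpa using this

theorem exists_max_support {t : ℤ →₀ ℝ} (ht : t ≠ 0) :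
    ∃ a : ℤ, t a ≠ 0 ∧ ∀ α, t α ≠ 0 → α ≤ a := by
  have hne := Finsupp.support_nonempty_iff.2 ht
  refine ⟨t.support.max' hne, Finsupp.mem_support_iff.1 (t.support.max'_mem hne), fun α hα => ?_⟩
  exact t.support.le_max' α (Finsupp.mem_support_iff.2 hα)

theorem zeroOrderAtInfty_eq {t : ℤ →₀ ℝ} {a : ℤ} (ha : t a ≠ 0)
    (hmax : ∀ α, t α ≠ 0 → α ≤ a) : zeroOrderAtInfty t = (-a).toNat := by
  refine le_antisymm (Nat.sInf_le ⟨a, Finsupp.mem_support_iff.2 ha, rfl⟩) ?_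
  refine le_csInf ⟨_, a, Finsupp.mem_support_iff.2 ha, rfl⟩ ?_
  rintro _ ⟨α, hα, rfl⟩
  have := hmax α (Finsupp.mem_support_iff.1 hα)
  dsimp only
  omega

theorem poleOrder_reflect {t : ℤ →₀ ℝ} {a : ℤ} (ha : t a ≠ 0)
    (hmax : ∀ α, t α ≠ 0 → α ≤ a) : poleOrder (reflect t) = a.toNat := by
  refine le_antisymm (Finset.sup_le fun α hα => ?_) ?_
  · have h : reflect t α ≠ 0 := Finsupp.mem_support_iff.1 hα
    have := hmax (-α) h
    omega
  · have h : -a ∈ (reflect t).support := Finsupp.mem_support_iff.2 (by simpa using ha)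
    have := neg_poleOrder_le h
    omega

theorem natDegree_numerator {t : ℤ →₀ ℝ} {a : ℤ} (ha : t a ≠ 0)
    (hmax : ∀ α, t α ≠ 0 → α ≤ a) : ((numerator t).natDegree : ℤ) = a + poleOrder t := by
  have h1 := neg_poleOrder_le (Finsupp.mem_support_iff.2 ha)
  have h2 : (numerator t).natDegree = (a + poleOrder t).toNat := by
    refine natDegree_eq_of_le_of_coeff_ne_zero ?_ ?_
    · rw [natDegree_le_iff_coeff_eq_zero]
      intro k hk
      rw [coeff_numerator, Complex.ofReal_eq_zero]
      by_contra h
      have := hmax _ h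
      omega
    · rw [coeff_numerator, Int.toNat_of_nonneg (by omega), Complex.ofReal_ne_zero]
      simpa using ha
  omega

/-- `f(1 / z)` has the reversed numerator, up to the zeros of `f` at infinity. -/
theorem numerator_reflect {t : ℤ →₀ ℝ} {a : ℤ} (ha : t a ≠ 0)
    (hmax : ∀ α, t α ≠ 0 → α ≤ a) :
    numerator (reflect t) = X ^ zeroOrderAtInfty t * (numerator t).reverse := by
  have hd := natDegree_numerator ha hmax
  ext k
  rw [coeff_numerator, coeff_X_pow_mul', zeroOrderAtInfty_eq ha hmax, poleOrder_reflect ha hmax,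
    reflect_apply]
  split_ifs with h1
  · rw [coeff_reverse]
    rcases le_or_gt (k - (-a).toNat) (numerator t).natDegree with h2 | h2
    · rw [revAt_le h2, coeff_numerator]
      congr 2
      omega
    · rw [revAt_eq_self_of_lt h2, coeff_eq_zero_of_natDegree_lt (by omega), Complex.ofReal_eq_zero]
      by_contra h
      have := neg_poleOrder_le (Finsupp.mem_support_iff.2 h)
      omega
  · rw [Complex.ofReal_eq_zero]
    by_contra h
    have := hmax _ h
    omega

/-- Reversing the coefficients inverts the nonzero roots; roots at the origin disappear. -/
theorem roots_reverse (P : ℂ[X]) (hP : P ≠ 0) :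
    P.reverse.roots = (P.roots.filter fun z => z ≠ 0).map fun z => z⁻¹ := by
  have hlin : ∀ z : ℂ, (X - C z).reverse = 1 - C z * X := by
    intro z
    have h1 := reflect_monomial (R := ℂ) 1 1
    rw [pow_one, revAt_le le_rfl, Nat.sub_self, pow_zero] at h1
    rw [reverse, natDegree_X_sub_C, reflect_sub, h1, reflect_C, pow_one]
  have hprod : ∀ S : Multiset ℂ, (S.map fun z => X - C z).prod.reverse.roots =
      (S.filter fun z => z ≠ 0).map fun z => z⁻¹ := by
    intro S
    induction S using Multiset.induction with
    | empty => simp [← C_1, -map_one]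
    | cons z S ih =>
      have hne : (S.map fun z => X - C z).prod.reverse ≠ 0 := by
        rw [Ne, reverse_eq_zero]
        exact (monic_multiset_prod_of_monic _ _ fun z _ => monic_X_sub_C z).ne_zero
      rw [Multiset.map_cons, Multiset.prod_cons, reverse_mul_of_domain, hlin]
      by_cases hz : z = 0
      · simp [hz, ih]
      · have h1 : (1 - C z * X : ℂ[X]) = C (-z) * (X - C z⁻¹) := by
          rw [mul_sub, ← C_mul, neg_mul, mul_inv_cancel₀ hz]
          simp
          ring
        rw [h1, mul_assoc, roots_C_mul _ (neg_ne_zero.2 hz),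
          roots_mul (mul_ne_zero (X_sub_C_ne_zero _) hne), ih, roots_X_sub_C,
          Multiset.filter_cons_of_pos (p := fun z => z ≠ 0) S hz, Multiset.map_cons, Multiset.singleton_add]
  conv_lhs => rw [(IsAlgClosed.splits P).eq_prod_roots]
  rw [reverse_mul_of_domain, reverse_C, roots_C_mul _ (leadingCoeff_ne_zero.2 hP), hprod]

/-- The inversion `z ↦ 1 / z`, with `1 / 0 = ∞`. -/
def inversion (z : ℂ) : OnePoint ℂ := if z = 0 then OnePoint.infty else ((z⁻¹ : ℂ) : OnePoint ℂ)

theorem modulus_inversion (z : ℂ) : modulus (inversion z) = ‖z‖ₑ⁻¹ := by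
  unfold inversion
  split_ifs with h
  · subst h
    rw [enorm_zero, ENNReal.inv_zero]
    rfl
  · change ‖z⁻¹‖ₑ = _
    exact enorm_inv h

theorem outsideLength_inversion (z : ℂ) : outsideLength (inversion z) = insideLength z := by
  unfold inversion
  split_ifs with h
  · subst h
    change (0 : ℝ) = _
    simp [insideLength]
  · change 1 / Real.log ‖z⁻¹‖ = -1 / Real.log ‖z‖
    rw [norm_inv, Real.log_inv, div_neg, neg_div]

theorem zerosInside_reflect {t : ℤ →₀ ℝ} (ht : t ≠ 0) :
    zerosInside (reflect t) = ((zeros t).filter fun z => 1 < ‖z‖).map (fun z => z⁻¹) +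
      Multiset.replicate (zeroOrderAtInfty t) 0 := by
  obtain ⟨a, ha, hmax⟩ := exists_max_support ht
  have hrev : (numerator t).reverse ≠ 0 := by
    rw [Ne, reverse_eq_zero]; exact numerator_ne_zero ht
  rw [zerosInside, zeros, numerator_reflect ha hmax, roots_mul (mul_ne_zero (pow_ne_zero _ X_ne_zero)
    hrev), roots_X_pow, Multiset.nsmul_singleton, roots_reverse _ (numerator_ne_zero ht), add_comm,
    Multiset.filter_add, Multiset.filter_map, Multiset.filter_filter]
  congr 1
  · congr 1
    refine Multiset.filter_congr fun z _ => ?_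
    rw [Function.comp_apply, norm_inv]
    constructor
    · rintro ⟨h1, h2⟩
      exact (inv_lt_one₀ (norm_pos_iff.2 h2)).1 h1
    · intro h
      have h0 : 0 < ‖z‖ := one_pos.trans h
      exact ⟨(inv_lt_one₀ h0).2 h, norm_pos_iff.1 h0⟩
  · rw [Multiset.filter_eq_self]
    intro z hz
    rw [Multiset.eq_of_mem_replicate hz]
    simp

theorem map_inversion_zerosInside_reflect {t : ℤ →₀ ℝ} (ht : t ≠ 0) :
    (zerosInside (reflect t)).map inversion = zerosOutside t := by
  rw [zerosInside_reflect ht, zerosOutside, Multiset.map_add, Multiset.map_replicate,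
    Multiset.map_map]
  congr 1
  · refine Multiset.map_congr rfl fun z hz => ?_
    have h0 : z ≠ 0 := norm_pos_iff.1 (one_pos.trans (Multiset.mem_filter.1 hz).2)
    simp [inversion, h0]
  · simp [inversion]

/-- Mirror reflection exchanges the two topological phases. -/
theorem omega_reflect {t : ℤ →₀ ℝ} (ht : t ≠ 0) : omega (reflect t) = -(omega t + twoC t) := by
  obtain ⟨a, ha, hmax⟩ := exists_max_support ht
  have h1 := natDegree_numerator ha hmax
  have h2 : (numerator t).roots.card = (numerator t).natDegree :=
    (IsAlgClosed.splits _).natDegree_eq_card_roots.symm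
  have h3 : (zeros t).card = (zerosInside t).card + ((zeros t).filter fun z => ‖z‖ = 1).card +
      ((zeros t).filter fun z => 1 < ‖z‖).card := by
    rw [zerosInside]
    have e1 := congrArg Multiset.card (Multiset.filter_add_not (fun z : ℂ => ‖z‖ < 1) (zeros t))
    have e2 := congrArg Multiset.card (Multiset.filter_add_not (fun z : ℂ => ‖z‖ = 1)
      ((zeros t).filter fun z => ¬ ‖z‖ < 1))
    rw [Multiset.card_add] at e1 e2
    rw [Multiset.filter_filter, Multiset.filter_filter] at e2
    have e3 : ((zeros t).filter fun z => ‖z‖ = 1 ∧ ¬ ‖z‖ < 1) =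
        (zeros t).filter fun z => ‖z‖ = 1 :=
      Multiset.filter_congr fun z _ => ⟨fun h => h.1, fun h => ⟨h, h.not_lt⟩⟩
    have e4 : ((zeros t).filter fun z => ¬ ‖z‖ = 1 ∧ ¬ ‖z‖ < 1) =
        (zeros t).filter fun z => 1 < ‖z‖ :=
      Multiset.filter_congr fun z _ =>
        ⟨fun h => lt_of_le_of_ne (not_lt.1 h.2) (Ne.symm h.1), fun h => ⟨h.ne', h.not_gt⟩⟩
    rw [e3, e4] at e2
    omega
  unfold zeros at h3
  rw [h2] at h3
  rw [omega, omega, twoC, zerosInside_reflect ht, poleOrder_reflect ha hmax, Multiset.card_add,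
    Multiset.card_map, Multiset.card_replicate, zeroOrderAtInfty_eq ha hmax]
  unfold zeros
  push_cast
  omega

theorem isSmallest_inversion {t : ℤ →₀ ℝ} (ht : t ≠ 0) {k : ℕ} {z : Fin k → ℂ}
    (hz : IsLargest (fun w : ℂ => ‖w‖) (zerosInside (reflect t)) z) :
    IsSmallest modulus (zerosOutside t) fun i => inversion (z i) := by
  obtain ⟨rest, h, hle⟩ := hz
  refine ⟨rest.map inversion, ?_, ?_⟩
  · rw [← map_inversion_zerosInside_reflect ht, h, Multiset.map_add, Multiset.map_map]
    rfl
  · intro i w hw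
    obtain ⟨x, hx, rfl⟩ := Multiset.mem_map.1 hw
    rw [modulus_inversion, modulus_inversion, ENNReal.inv_le_inv, enorm_le_iff_norm_le]
    exact hle i x hx

end

/-! ### Zero modes of the two boundaries -/

section

variable {Λ : Set ℤ}

theorem hasExpansion_of_hasSum {Γ : Op Λ} {σ : Bool} {y : Λ → ℝ}
    (h : HasSum (fun n => (y n : ℂ) • majorana (σ, n)) Γ) :
    HasExpansion Γ (if σ then y else 0) (if σ then 0 else y) := by
  unfold HasExpansion
  cases σ <;> simpa [majorana] using h

/-- The anticommutator of two modes of the same kind is twice the inner product of their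
amplitudes. -/
theorem anticomm_of_hasSum {Γ Γ' : Op Λ} {σ : Bool} {y y' : Λ → ℝ} {r : ℝ}
    (h : HasSum (fun n => (y n : ℂ) • majorana (σ, n)) Γ)
    (h' : HasSum (fun n => (y' n : ℂ) • majorana (σ, n)) Γ') (hr : HasSum (fun n => y n * y' n) r) :
    Γ * Γ' + Γ' * Γ = algebraMap ℂ (Op Λ) ((2 * r : ℝ) : ℂ) := by
  have h1 := (h.mul_right Γ').add (h.mul_left Γ')
  refine h1.unique ?_
  have h2 : ∀ n, ((y n : ℂ) • majorana (σ, n)) * Γ' + Γ' * ((y n : ℂ) • majorana (σ, n)) =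
      algebraMap ℂ (Op Λ) ((2 * (y n * y' n) : ℝ) : ℂ) := by
    intro n
    have h3 := (hasExpansion_of_hasSum h').anticomm (σ, n)
    rw [smul_mul_assoc, mul_smul_comm, ← smul_add, add_comm (majorana (σ, n) * Γ'), h3,
      Algebra.smul_def, ← map_mul]
    congr 1
    cases σ <;> (simp; ring)
  simp only [h2]
  exact hasSum_algebraMap.2 (hr.mul_left 2)

/-- Combinations of the `γ_n` are real, combinations of the `γ̃_n` are imaginary. -/
theorem timeReversal_of_hasSum {Γ : Op Λ} {σ : Bool} {y : Λ → ℝ}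
    (h : HasSum (fun n => (y n : ℂ) • majorana (σ, n)) Γ) (ψ : Fock Λ) :
    timeReversal (Γ (timeReversal ψ)) = if σ then Γ ψ else -Γ ψ := by
  have happ : ∀ φ : Fock Λ, HasSum (fun n => (y n : ℂ) • majorana (σ, n) φ) (Γ φ) := fun φ => by
    exact h.mapL (ContinuousLinearMap.apply ℂ (Fock Λ) φ)
  have h1 : HasSum (fun n => timeReversal ((y n : ℂ) • majorana (σ, n) (timeReversal ψ)))
      (timeReversal (Γ (timeReversal ψ))) := (happ (timeReversal ψ)).star
  have h2 : ∀ n, timeReversal ((y n : ℂ) • majorana (σ, n) (timeReversal ψ)) =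
      (y n : ℂ) • if σ then majorana (σ, n) ψ else -majorana (σ, n) ψ := by
    intro n
    have h3 := timeReversal_majorana (σ, n) ψ
    dsimp only at h3
    rw [← h3]
    change star _ = _ • star _
    rw [star_smul]
    simp
  simp only [h2] at h1
  refine h1.unique ?_
  cases σ
  · simpa using (happ ψ).neg
  · simpa using happ ψ

section Edge

/-- `ι` numbers the sites of a half-infinite chain from its boundary, and `s true`, `s false` are the
Toeplitz symbols for the amplitudes of the `γ_n` and of the `γ̃_n`. -/
structure IsEdgeNumbering (t : ℤ →₀ ℝ) (ι : ℕ ≃ Λ) (s : Bool → ℤ →₀ ℝ) : Prop where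
  abs_site : ∀ n, |((ι n : ℤ) : ℝ)| = n + 1
  symbol_gam : ∀ n m : ℕ, t ((ι m : ℤ) - ι n) = s true ((m : ℤ) - n)
  symbol_gamTilde : ∀ n m : ℕ, t ((ι m : ℤ) - ι n) = s false ((n : ℤ) - m)

variable {t : ℤ →₀ ℝ} {ι : ℕ ≃ Λ} {s : Bool → ℤ →₀ ℝ}

/-- Whether the kernel condition involves `t` or its mirror image depends on the side of the boundary and
on the kind of Majorana operators; that is all that distinguishes the four cases. -/
theorem IsEdgeNumbering.isZeroMode_iff (hι : IsEdgeNumbering t ι s) {Γ : Op Λ} {b b' : Λ → ℝ}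
    (h : HasExpansion Γ b b') :
    IsZeroMode t Γ ↔ InToeplitzKernel (s true) (b ∘ ι) ∧ InToeplitzKernel (s false) (b' ∘ ι) := by
  have h1 : IsZeroMode t Γ ↔ CommutesWithHamiltonian t Γ := and_iff_right ⟨b, b', h⟩
  rw [h1, commutesWithHamiltonian_iff h]
  refine and_congr (ι.forall_congr_right.symm.trans (forall_congr' fun n => ?_))
    (ι.forall_congr_right.symm.trans (forall_congr' fun m => ?_))
  · rw [← ι.hasSum_iff]
    simp only [Function.comp_def, hι.symbol_gam]
  · rw [← ι.hasSum_iff]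
    simp only [Function.comp_def, hι.symbol_gamTilde]

theorem exists_amplitudes {x : ℕ → ℝ} (h : Summable fun n => x n ^ 2) :
    ∃ y : Amplitudes, ⇑y = x := by
  refine ⟨⟨x, (memℓp_gen_iff (p := 2) (by norm_num)).2 ?_⟩, rfl⟩
  simpa using h

theorem lt_exp_of_insideLength_lt {z : ℂ} (hz : ‖z‖ < 1) {ξ : ℝ} (hξ : 0 < ξ)
    (h : insideLength z < ξ) : ‖z‖ < Real.exp (-1 / ξ) := by
  rcases (norm_nonneg z).eq_or_lt with h0 | h0
  · rw [← h0]; exact Real.exp_pos _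
  · rw [← Real.log_lt_iff_lt_exp h0]
    have hl : Real.log ‖z‖ < 0 := Real.log_neg h0 hz
    rw [insideLength, div_lt_iff_of_neg hl] at h
    rw [lt_div_iff₀ hξ]
    linarith

theorem exp_lt_of_lt_insideLength {z : ℂ} (hz : ‖z‖ < 1) {ξ : ℝ} (hξ : 0 < ξ)
    (h : ξ < insideLength z) : Real.exp (-1 / ξ) < ‖z‖ := by
  rcases (norm_nonneg z).eq_or_lt with h0 | h0
  · rw [insideLength, ← h0] at h
    simp at h
    exact absurd h hξ.not_gt
  · rw [← Real.lt_log_iff_exp_lt h0]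
    have hl : Real.log ‖z‖ < 0 := Real.log_neg h0 hz
    rw [insideLength, lt_div_iff_of_neg hl] at h
    rw [div_lt_iff₀ hξ]
    linarith

theorem insideLength_nonneg {z : ℂ} (hz : ‖z‖ < 1) : 0 ≤ insideLength z :=
  div_nonneg_of_nonpos (by norm_num) (Real.log_nonpos (norm_nonneg z) hz.le)

/-- Exponential localization with length `ξ` is geometric decay with ratio `exp (-1 / ξ)`. -/
theorem IsEdgeNumbering.bound_iff (hι : IsEdgeNumbering t ι s) (x : ℕ → ℝ) (ξ : ℝ) :
    (∃ C : ℝ, ∀ n : Λ, |x (ι.symm n)| ≤ C * Real.exp (-|((n : ℤ) : ℝ)| / ξ)) ↔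
      ∃ K : ℝ, ∀ n, |x n| ≤ K * Real.exp (-1 / ξ) ^ n := by
  have h : ∀ n : ℕ, Real.exp (-|((ι n : ℤ) : ℝ)| / ξ) =
      Real.exp (-1 / ξ) * Real.exp (-1 / ξ) ^ n := by
    intro n
    rw [hι.abs_site, ← Real.exp_nat_mul, ← Real.exp_add]
    congr 1
    ring
  constructor
  · rintro ⟨C, hC⟩
    refine ⟨C * Real.exp (-1 / ξ), fun n => ?_⟩
    have := hC (ι n)
    rwa [h, ι.symm_apply_apply, ← mul_assoc] at this
  · rintro ⟨K, hK⟩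
    refine ⟨K / Real.exp (-1 / ξ), fun n => ?_⟩
    obtain ⟨n, rfl⟩ := ι.surjective n
    rw [h, ι.symm_apply_apply, ← mul_assoc, div_mul_cancel₀ _ (Real.exp_pos _).ne']
    exact hK n

/-- A zero mode has no component of the kind whose Toeplitz kernel is trivial, and its amplitudes of the
other kind are a combination of the basis. -/
theorem IsEdgeNumbering.exists_eq_sum (hι : IsEdgeNumbering t ι s) (σ : Bool) {k : ℕ}
    {v : Fin k → Amplitudes}
    (hspan : ∀ x : Amplitudes, InToeplitzKernel (s σ) x ↔ x ∈ Submodule.span ℝ (Set.range v))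
    (htriv : ∀ x : Amplitudes, InToeplitzKernel (s !σ) x → x = 0) {Γ : Fin k → Op Λ}
    (hΓ : ∀ i, HasSum (fun n : Λ => (v i (ι.symm n) : ℂ) • majorana (σ, n)) (Γ i))
    {Γ' : Op Λ} (hΓ' : IsZeroMode t Γ') : ∃ a : Fin k → ℝ, Γ' = ∑ i, (a i : ℂ) • Γ i := by
  obtain ⟨b, b', hb⟩ := hΓ'.1
  obtain ⟨h1, h2⟩ := (hι.isZeroMode_iff hb).1 hΓ'
  let c : Bool → Λ → ℝ := fun τ => if τ then b else b'
  have hsq : ∀ τ : Bool, Summable fun n : ℕ => c τ (ι n) ^ 2 := by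
    intro τ
    cases τ
    · exact ι.summable_iff (f := fun n => b' n ^ 2) |>.2 hb.summable_sq.2
    · exact ι.summable_iff (f := fun n => b n ^ 2) |>.2 hb.summable_sq.1
  have hker : ∀ τ : Bool, InToeplitzKernel (s τ) fun n => c τ (ι n) := by
    intro τ
    cases τ
    · exact h2
    · exact h1
  obtain ⟨x, hx⟩ := exists_amplitudes (hsq σ)
  obtain ⟨y, hy⟩ := exists_amplitudes (hsq !σ)
  have hy0 : y = 0 := htriv y (by rw [hy]; exact hker _)
  have hxs := (hspan x).1 (by rw [hx]; exact hker _)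
  obtain ⟨a, ha⟩ := (Submodule.mem_span_range_iff_exists_fun ℝ).1 hxs
  refine ⟨a, ?_⟩
  have hcσ : ∀ n : Λ, c σ n = ∑ i, a i * v i (ι.symm n) := by
    intro n
    have h3 : x (ι.symm n) = c σ n := by rw [hx]; simp
    rw [← h3, ← ha, lp.coeFn_sum, Finset.sum_apply]
    rfl
  have hcσ' : ∀ n : Λ, c (!σ) n = 0 := by
    intro n
    have h3 : y (ι.symm n) = c (!σ) n := by rw [hy]; simp
    rw [← h3, hy0]
    rfl
  have h3 : HasSum (fun n : Λ => (c σ n : ℂ) • majorana (σ, n)) Γ' := by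
    unfold HasExpansion at hb
    convert hb using 2 with n
    have h4 := hcσ' n
    cases σ
    · have : b n = 0 := h4
      simp [this, c, majorana]
    · have : b' n = 0 := h4
      simp [this, c, majorana]
  refine h3.unique ?_
  have h6 := hasSum_sum fun i (_ : i ∈ Finset.univ) => (hΓ i).const_smul ((a i : ℝ) : ℂ)
  convert h6 using 2 with n
  rw [hcσ]
  simp only [smul_smul]
  rw [← Finset.sum_smul]
  push_cast
  rfl

/-- If the Toeplitz kernel for one kind of Majorana operators is trivial, then an orthonormal basis of the
kernel for the other kind gives all zero modes of the boundary. -/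
theorem IsEdgeNumbering.exists_zeroModes (hι : IsEdgeNumbering t ι s) (σ : Bool) {k : ℕ}
    {z : Fin k → ℂ} {v : Fin k → Amplitudes} (hv : Orthonormal ℝ v)
    (hspan : ∀ x : Amplitudes, InToeplitzKernel (s σ) x ↔ x ∈ Submodule.span ℝ (Set.range v))
    (hdecay : ∀ i, ‖z i‖ < 1 ∧
      (∀ s, ‖z i‖ < s → s < 1 → ∃ K, ∀ n, |v i n| ≤ K * s ^ n) ∧
      ∀ s, 0 < s → s < ‖z i‖ → ¬ ∃ K, ∀ n, |v i n| ≤ K * s ^ n)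
    (htriv : ∀ x : Amplitudes, InToeplitzKernel (s !σ) x → x = 0) :
    ∃ Γ : Fin k → Op Λ, AreTheZeroModes t Γ ∧
      ∀ i, (∀ ψ, timeReversal (Γ i (timeReversal ψ)) = if σ then Γ i ψ else -Γ i ψ) ∧
        HasLocalizationLength (Γ i) (insideLength (z i)) := by
  have hsum : ∀ x : Amplitudes, ∃ Γ : Op Λ,
      HasSum (fun n : Λ => (x (ι.symm n) : ℂ) • majorana (σ, n)) Γ := fun x =>
    summable_majorana (u := fun n : Λ => (σ, n)) (fun _ _ h => (Prod.mk.inj h).2)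
      (a := fun n => x (ι.symm n)) (ι.symm.summable_iff.2 (summable_sq_amplitudes x))
  choose Γ hΓ using fun i => hsum (v i)
  have hzero : InToeplitzKernel (s !σ) (0 : ℕ → ℝ) := fun n => by simp
  refine ⟨Γ, ⟨fun i => ?_, fun i j => ?_, fun Γ' hΓ' => ?_⟩, fun i => ⟨?_, ?_, ?_⟩⟩
  · rw [hι.isZeroMode_iff (hasExpansion_of_hasSum (hΓ i))]
    have h1 := (hspan (v i)).2 (Submodule.subset_span ⟨i, rfl⟩)
    have h2 : (fun n : Λ => v i (ι.symm n)) ∘ ι = v i := by ext n; simp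
    cases σ
    · exact ⟨hzero, by simpa [h2] using h1⟩
    · exact ⟨by simpa [h2] using h1, hzero⟩
  · have h1 : HasSum (fun n : Λ => v i (ι.symm n) * v j (ι.symm n)) (inner ℝ (v i) (v j)) := by
      have h2 := lp.hasSum_inner (𝕜 := ℝ) (v i) (v j)
      rw [← ι.symm.hasSum_iff] at h2
      have h3 : ∀ n : Λ, inner ℝ (v i (ι.symm n)) (v j (ι.symm n)) =
          v i (ι.symm n) * v j (ι.symm n) := fun n => mul_comm (v j (ι.symm n)) _
      simp only [Function.comp_def, h3] at h2
      exact h2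
    rw [anticomm_of_hasSum (hΓ i) (hΓ j) h1, orthonormal_iff_ite.1 hv]
    split_ifs
    · simp [map_ofNat]
    · simp
  · exact hι.exists_eq_sum σ hspan htriv hΓ hΓ'
  · exact timeReversal_of_hasSum (hΓ i)
  · exact insideLength_nonneg (hdecay i).1
  · refine ⟨_, _, hasExpansion_of_hasSum (hΓ i), ?_⟩
    have h1 : ∀ n : Λ, |(if σ then (fun n : Λ => v i (ι.symm n)) else 0) n| +
        |(if σ then 0 else (fun n : Λ => v i (ι.symm n))) n| = |v i (ι.symm n)| := by
      intro n; cases σ <;> simp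
    simp only [h1]
    constructor
    · intro ξ hξ
      have hξ0 := (insideLength_nonneg (hdecay i).1).trans_lt hξ
      rw [hι.bound_iff (v i)]
      refine (hdecay i).2.1 _ (lt_exp_of_insideLength_lt (hdecay i).1 hξ0 hξ) ?_
      rw [Real.exp_lt_one_iff]
      exact div_neg_of_neg_of_pos (by norm_num) hξ0
    · intro ξ hξ0 hξ
      rw [hι.bound_iff (v i)]
      exact (hdecay i).2.2 _ (Real.exp_pos _) (exp_lt_of_lt_insideLength (hdecay i).1 hξ0 hξ)

end Edge

/-- The sites of the chain with a left boundary, numbered from the boundary. -/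
def leftSites : ℕ ≃ leftEdge where
  toFun n := ⟨n + 1, by simp [leftEdge]⟩
  invFun m := ((m : ℤ) - 1).toNat
  left_inv n := by simp
  right_inv m := by
    have : (1 : ℤ) ≤ m := m.2
    ext
    simp
    omega

/-- The sites of the chain with a right boundary, numbered from the boundary. -/
def rightSites : ℕ ≃ rightEdge where
  toFun n := ⟨-(n + 1), by simp [rightEdge]⟩
  invFun m := (-(m : ℤ) - 1).toNat
  left_inv n := by simp
  right_inv m := by
    have : (m : ℤ) ≤ -1 := m.2
    ext
    simp
    omega

theorem isEdgeNumbering_leftSites (t : ℤ →₀ ℝ) :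
    IsEdgeNumbering t leftSites fun σ => if σ then t else reflect t where
  abs_site n := by
    change |(((n : ℤ) + 1 : ℤ) : ℝ)| = _
    push_cast
    exact abs_of_nonneg (by positivity)
  symbol_gam n m := by simp [leftSites]
  symbol_gamTilde n m := by simp [leftSites]

theorem isEdgeNumbering_rightSites (t : ℤ →₀ ℝ) :
    IsEdgeNumbering t rightSites fun σ => if σ then reflect t else t where
  abs_site n := by
    change |((-((n : ℤ) + 1) : ℤ) : ℝ)| = _
    push_cast
    rw [abs_neg]
    exact abs_of_nonneg (by positivity)
  symbol_gam n m := by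
    simp only [rightSites, Equiv.coe_fn_mk, if_true, reflect_apply]
    congr 1
    ring
  symbol_gamTilde n m := by
    simp only [rightSites, Equiv.coe_fn_mk]
    change _ = t _
    congr 1
    ring

theorem eq_zero_of_inToeplitzKernel {t : ℤ →₀ ℝ} (ht : t ≠ 0) (hω : omega t ≤ 0) (x : Amplitudes)
    (hx : InToeplitzKernel t x) : x = 0 := by
  obtain ⟨-, -, v, -, hspan, -⟩ := exists_toeplitzKernel_basis ht (k := 0) (by omega)
  simpa using (hspan x).1 hx

end

end BDI

end

theorem theorem1 (t : ℤ →₀ ℝ) (ht : t ≠ 0) :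
    (0 < BDI.omega t →
      ∃ z : Fin (BDI.omega t).natAbs → ℂ,
        BDI.IsLargest (fun w : ℂ => ‖w‖) (BDI.zerosInside t) z ∧
        (∃ Γ : Fin (BDI.omega t).natAbs → BDI.Op BDI.leftEdge,
          BDI.AreTheZeroModes t Γ ∧
          ∀ i, BDI.IsRealMode (Γ i) ∧
            BDI.HasLocalizationLength (Γ i) (BDI.insideLength (z i))) ∧
        (∃ Γ : Fin (BDI.omega t).natAbs → BDI.Op BDI.rightEdge,
          BDI.AreTheZeroModes t Γ ∧
          ∀ i, BDI.IsImaginaryMode (Γ i) ∧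
            BDI.HasLocalizationLength (Γ i) (BDI.insideLength (z i)))) ∧
    (BDI.omega t < -BDI.twoC t →
      ∃ z : Fin (BDI.omega t + BDI.twoC t).natAbs → OnePoint ℂ,
        BDI.IsSmallest BDI.modulus (BDI.zerosOutside t) z ∧
        (∃ Γ : Fin (BDI.omega t + BDI.twoC t).natAbs → BDI.Op BDI.leftEdge,
          BDI.AreTheZeroModes t Γ ∧
          ∀ i, BDI.IsImaginaryMode (Γ i) ∧
            BDI.HasLocalizationLength (Γ i) (BDI.outsideLength (z i))) ∧
        (∃ Γ : Fin (BDI.omega t + BDI.twoC t).natAbs → BDI.Op BDI.rightEdge,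
          BDI.AreTheZeroModes t Γ ∧
          ∀ i, BDI.IsRealMode (Γ i) ∧
            BDI.HasLocalizationLength (Γ i) (BDI.outsideLength (z i)))) ∧
    (-BDI.twoC t ≤ BDI.omega t → BDI.omega t ≤ 0 →
      (∀ Γ : BDI.Op BDI.leftEdge, BDI.IsZeroMode t Γ → Γ = 0) ∧
      (∀ Γ : BDI.Op BDI.rightEdge, BDI.IsZeroMode t Γ → Γ = 0)) := by
  have hreflect := BDI.omega_reflect ht
  have ht' := BDI.reflect_ne_zero ht
  have hL := BDI.isEdgeNumbering_leftSites t
  have hR := BDI.isEdgeNumbering_rightSites t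
  have hc : 0 ≤ BDI.twoC t := Int.natCast_nonneg _
  refine ⟨fun hω => ?_, fun hω => ?_, fun hω₁ hω₂ => ?_⟩
  · have htriv := BDI.eq_zero_of_inToeplitzKernel ht' (by omega)
    obtain ⟨z, hz, v, hv, hspan, hdecay⟩ :=
      BDI.exists_toeplitzKernel_basis ht (k := (BDI.omega t).natAbs) (by omega)
    exact ⟨z, hz, hL.exists_zeroModes true hv hspan hdecay htriv,
      hR.exists_zeroModes false hv hspan hdecay htriv⟩
  · have htriv := BDI.eq_zero_of_inToeplitzKernel ht (by omega)
    obtain ⟨z, hz, v, hv, hspan, hdecay⟩ :=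
      BDI.exists_toeplitzKernel_basis ht' (k := (BDI.omega t + BDI.twoC t).natAbs) (by omega)
    refine ⟨fun i => BDI.inversion (z i), BDI.isSmallest_inversion ht hz, ?_, ?_⟩
    · simp only [BDI.outsideLength_inversion]
      exact hL.exists_zeroModes false hv hspan hdecay htriv
    · simp only [BDI.outsideLength_inversion]
      exact hR.exists_zeroModes true hv hspan hdecay htriv
  · have htriv := BDI.eq_zero_of_inToeplitzKernel ht hω₂
    have htriv' := BDI.eq_zero_of_inToeplitzKernel ht' (by omega)
    obtain ⟨z, -, v, hv, hspan, hdecay⟩ := BDI.exists_toeplitzKernel_basis ht (k := 0) (by omega)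
    obtain ⟨_, hΓ, -⟩ := hL.exists_zeroModes true hv hspan hdecay htriv'
    obtain ⟨_, hΓ', -⟩ := hR.exists_zeroModes false hv hspan hdecay htriv'
    refine ⟨fun Γ h => ?_, fun Γ h => ?_⟩
    · obtain ⟨a, ha⟩ := hΓ.complete Γ h
      simpa using ha
    · obtain ⟨a, ha⟩ := hΓ'.complete Γ h
      simpa using ha
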